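/- \textbf{Setting.} Let $X,Y\subset\mathbb R^d$ be compact, $X\neq\emptyset$, and let $\mu,\nu$ be finite positive Borel measures carried by $X$ and $Y$. Let $\varphi:[0,\infty)\to[0,\infty]$ be convex and lower semicontinuous with $\varphi(1)=0$, let $\varphi^*(s)=\sup_{r\ge 0}(rs-\varphi(r))$, and let $q(x)=\tfrac12\|x\|^2$. For $z:\mathbb R^d\to(-\infty,+\infty]$ let $z^*(y)=\sup_{x}(\langle x,y\rangle-z(x))$ (a function given only on $X$ is extended by $+\infty$, so that the supremum is then over $X$). The semi-dual of unbalanced optimal transport is $$J(z)=\langle\varphi^*(z-q),\mu\rangle+\langle\varphi^*(z^*-q),\nu\rangle\in(-\infty,+\infty],$$ defined for $z:\mathbb R^d\to(-\infty,+\infty]$ finite and continuous on $X$. A \emph{potential} is such a $z$ that is moreover convex; a potential $z_0$ is \emph{optimal} if it minimizes $J$ among all potentials. \textbf{Proposition (Stability estimate).} The functional $J$ is convex. Assume that $\varphi^*$ is finite and differentiable on $\mathbb R$ and that $\nu$ is absolutely continuous with respect to the Lebesgue measure. Let $z_0$ be an optimal potential, let $z$ be a $\lambda$-strongly convex potential,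 $\lambda>0$, and put $\tilde\nu=(\varphi^*)'(z_0^*-q)\,\nu$. Then $J(z)$ and $J(z_0)$ are finite, $z^*$ is finite and differentiable on $\mathbb R^d$, $z_0^*$ is finite and differentiable $\nu$-almost everywhere, and $$J(z)-J(z_0)\ \ge\ \frac{\lambda}{2}\,\mathbb E_{\tilde\nu}\big[\|\nabla(z_0^*-z^*)\|^2\big]+C_{z^*}\,\mathbb E_\nu\big[(z_0^*-z^*)^2\big]+C_z\,\mathbb E_\mu\big[(z_0-z)^2\big],$$ where $\mathbb E_\rho[f]=\int f\,d\rho$ and $C_z,C_{z^*}\ge 0$ are the convexity constants $$C_z=\inf_{x\in\mathrm{supp}\,\mu}c\big(z_0(x)-q(x),\,z(x)-q(x)\big),\qquad C_{z^*}=\inf_{y\in\mathrm{supp}\,\nu}c\big(z_0^*(y)-q(y),\,z^*(y)-q(y)\big),$$ $c(a,b)$ being the largest $c\in[0,\infty]$ with $\varphi^*(b)-\varphi^*(a)\ge(\varphi^*)'(a)(b-a)+c\,(b-a)^2$ (so $c(a,a)=\infty$; $\infty\cdot 0=0$; at the points of a $\nu$-null set where $z_0^*$ may be infinite, it is replaced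 by $0$ in the formula for $C_{z^*}$). If moreover $\varphi^*$ is strongly convex on every compact interval, then for every $M$ there is $C'>0$ such that, for every $\lambda>0$ and every $\lambda$-strongly convex potential $z$ with $|z|\le M$ on $\mathrm{supp}\,\mu$ and $|z^*|\le M$ on $\mathrm{supp}\,\nu$, one has $C_z\ge C'$ and $C_{z^*}\ge C'$. Hence for all such $z$ $$J(z)-J(z_0)\ \ge\ \frac{\lambda}{2}\,\mathbb E_{\tilde\nu}\big[\|\nabla(z_0^*-z^*)\|^2\big]+C'\Big(\mathbb E_\nu\big[(z_0^*-z^*)^2\big]+\mathbb E_\mu\big[(z_0-z)^2\big]\Big).$$ -/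

import Mathlib

open MeasureTheory Set Filter Topology
open scoped NNReal ENNReal RealInnerProductSpace

noncomputable section

namespace UOT

/-- An entropy function: convex, lower semicontinuous `φ : [0, ∞) → [0, ∞]` with `φ 1 = 0`. -/
structure IsEntropy (φ : ℝ≥0 → ℝ≥0∞) : Prop where
  convex : ConvexOn ℝ≥0 univ φ
  lsc : LowerSemicontinuous φ
  map_one : φ 1 = 0

/-- The Legendre transform `φ* s = sup_{r ≥ 0} (r s - φ r)`, as an extended real function.  It is
also evaluated at `s = ⊤` (where it equals `⊤` for an entropy function), because the conjugate of a
potential may be infinite at some points. -/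
def entropyConj (φ : ℝ≥0 → ℝ≥0∞) (s : EReal) : EReal :=
  ⨆ r : ℝ≥0, ((r : ℝ) : EReal) * s - (φ r : EReal)

/-- `φ*` as a real function on `ℝ` (used where `φ*` is finite). -/
def entropyConjReal (φ : ℝ≥0 → ℝ≥0∞) (s : ℝ) : ℝ :=
  (entropyConj φ (s : EReal)).toReal

/-- The quadratic function `q x = ‖x‖² / 2`. -/
def quad {d : ℕ} (x : EuclideanSpace ℝ (Fin d)) : ℝ := ‖x‖ ^ 2 / 2

/-- The Legendre-Fenchel conjugate `z* y = sup_x (⟪x, y⟫ - z x)`.  A function that is only given on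
a set is extended by `⊤`, and then the supremum runs over that set. -/
def fenchel {d : ℕ} (z : EuclideanSpace ℝ (Fin d) → EReal) (y : EuclideanSpace ℝ (Fin d)) : EReal :=
  ⨆ x : EuclideanSpace ℝ (Fin d), ((⟪x, y⟫ : ℝ) : EReal) - z x

/-- The integral of an extended real function, `∫ f⁺ - ∫ f⁻`. -/
def eintegral {α : Type*} [MeasurableSpace α] (μ : Measure α) (f : α → EReal) : EReal :=
  ((∫⁻ x, (f x).toENNReal ∂μ : ℝ≥0∞) : EReal) - ((∫⁻ x, (-f x).toENNReal ∂μ : ℝ≥0∞) : EReal)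

/-- The semi-dual functional `J z = ⟨φ*(z - q), μ⟩ + ⟨φ*(z* - q), ν⟩`. -/
def semiDual {d : ℕ} (φ : ℝ≥0 → ℝ≥0∞) (μ ν : Measure (EuclideanSpace ℝ (Fin d)))
    (z : EuclideanSpace ℝ (Fin d) → EReal) : EReal :=
  eintegral μ (fun x => entropyConj φ (z x - (quad x : EReal))) +
    eintegral ν (fun y => entropyConj φ (fenchel z y - (quad y : EReal)))

/-- Functions with values in `(-∞, ∞]` that are finite and continuous on `X`. -/
structure IsAdmissible {d : ℕ} (X : Set (EuclideanSpace ℝ (Fin d)))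
    (z : EuclideanSpace ℝ (Fin d) → EReal) : Prop where
  ne_bot : ∀ x, z x ≠ ⊥
  ne_top : ∀ x ∈ X, z x ≠ ⊤
  continuousOn : ContinuousOn z X

/-- `m`-strong convexity of a function with values in `(-∞, ∞]`; `m = 0` is convexity. -/
def StronglyConvex {d : ℕ} (m : ℝ) (z : EuclideanSpace ℝ (Fin d) → EReal) : Prop :=
  ∀ x y : EuclideanSpace ℝ (Fin d), ∀ a b : ℝ, 0 ≤ a → 0 ≤ b → a + b = 1 →
    z (a • x + b • y) + ((m / 2 * (a * b) * ‖x - y‖ ^ 2 : ℝ) : EReal)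
      ≤ (a : EReal) * z x + (b : EReal) * z y

/-- Potentials: convex functions `z : ℝᵈ → (-∞, ∞]` that are finite and continuous on `X`. -/
def IsPotential {d : ℕ} (X : Set (EuclideanSpace ℝ (Fin d)))
    (z : EuclideanSpace ℝ (Fin d) → EReal) : Prop :=
  IsAdmissible X z ∧ StronglyConvex 0 z

/-- `z₀` is an optimal potential: a minimizer of the semi-dual among the potentials. -/
def IsOptimal {d : ℕ} (φ : ℝ≥0 → ℝ≥0∞) (X : Set (EuclideanSpace ℝ (Fin d)))
    (μ ν : Measure (EuclideanSpace ℝ (Fin d))) (z₀ : EuclideanSpace ℝ (Fin d) → EReal) : Prop :=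
  IsPotential X z₀ ∧ ∀ z, IsPotential X z → semiDual φ μ ν z₀ ≤ semiDual φ μ ν z

/-- `ν̃ = (φ*)'(z₀* - q) ν`. -/
def tiltedTarget {d : ℕ} (φ : ℝ≥0 → ℝ≥0∞) (ν : Measure (EuclideanSpace ℝ (Fin d)))
    (z₀ : EuclideanSpace ℝ (Fin d) → EReal) : Measure (EuclideanSpace ℝ (Fin d)) :=
  ν.withDensity fun y =>
    ENNReal.ofReal (deriv (entropyConjReal φ) ((fenchel z₀ y).toReal - quad y))

/-- The largest `c ∈ [0, ∞]` such that
`φ*(b) - φ*(a) ≥ (φ*)'(a) (b - a) + c (b - a)²` (`c = ∞` if `a = b`, when there is no condition). -/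
def convexityModulus (φ : ℝ≥0 → ℝ≥0∞) (a b : ℝ) : ℝ≥0∞ :=
  open Classical in
  if a = b then ⊤ else
    ENNReal.ofReal ((entropyConjReal φ b - entropyConjReal φ a
      - deriv (entropyConjReal φ) a * (b - a)) / (b - a) ^ 2)

/-- The constant `inf_{x ∈ supp ρ} c(f₀ x - q x, f x - q x)`, with `c` the modulus above.  It is
`C_z` for `(ρ, f₀, f) = (μ, z₀, z)` and `C_{z*}` for `(ρ, f₀, f) = (ν, z₀*, z*)`. -/
def stabConst {d : ℕ} (φ : ℝ≥0 → ℝ≥0∞) (ρ : Measure (EuclideanSpace ℝ (Fin d)))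
    (f₀ f : EuclideanSpace ℝ (Fin d) → EReal) : ℝ≥0∞ :=
  ⨅ x ∈ ρ.support, convexityModulus φ ((f₀ x).toReal - quad x) ((f x).toReal - quad x)

/-- `E_ρ[(f - g)²]`. -/
def sqDist {d : ℕ} (ρ : Measure (EuclideanSpace ℝ (Fin d)))
    (f g : EuclideanSpace ℝ (Fin d) → EReal) : ℝ≥0∞ :=
  ∫⁻ x, ENNReal.ofReal (((f x).toReal - (g x).toReal) ^ 2) ∂ρ

/-- `E_ρ[‖∇(f - g)‖²]`. -/
def gradSqDist {d : ℕ} (ρ : Measure (EuclideanSpace ℝ (Fin d)))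
    (f g : EuclideanSpace ℝ (Fin d) → EReal) : ℝ≥0∞ :=
  ∫⁻ x, ENNReal.ofReal (‖gradient (fun u => (f u).toReal - (g u).toReal) x‖ ^ 2) ∂ρ

end UOT

end

/-! Convexity: `φ*` is a supremum of affine functions with slopes `r ≥ 0`, hence convex and
nondecreasing, and `z ↦ z*(y)` is a supremum of affine functionals of `z`. Monotonicity of `φ*`
makes the composition convex, and integration preserves this.

Stability: let `w_t = (1 - t) z₀ + t z`, again a potential. Optimality gives `J(w_t) ≥ J(z₀)`, so
`J(z) - J(z₀)` dominates `J(z) - J(z₀) - (J(w_t) - J(z₀)) / t`. This is the integral of two gaps,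
nonnegative by convexity, so Fatou's lemma applies as `t → 0⁺`. On `X` the limiting gap is the
Bregman divergence of `φ*`. On the `ν` side there is an extra gain: with `T = ∇z₀*(y)` and `S =
∇z*(y)`, near-maximizers for `w_t*(y)` concentrate at `T`, while strong convexity of `z` costs `λ/2
‖x - S‖²` at `x`. Hence `w_t*(y)` lies below `(1 - t) z₀*(y) + t z*(y)` by nearly `t λ/2 ‖T - S‖²`,
and `(φ*)' ≥ 0` carries the gain over to the integrand (`fenchel_interpolation_le`,
`lintegral_bregman_le`). The convexity constants bound the Bregman divergences below by squares.

Uniform constants: the arguments of `φ*` must stay in one compact interval. The only difficulty is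
`z₀*`, controlled a priori only `ν`-almost everywhere. Truncating `z₀` to a ball containing `X`
gives a competitor with finite continuous conjugate; optimality and strict monotonicity of `φ*` make
the two conjugates agree on `supp ν` (`IsOptimal.exists_continuous_eq_fenchel`). -/

namespace UOT

/-! ### Monotonicity and convexity of the entropy conjugate. -/

section EntropyConj

variable {φ : ℝ≥0 → ℝ≥0∞}

lemma entropyConj_mono (φ : ℝ≥0 → ℝ≥0∞) : Monotone (entropyConj φ) := by
  intro s t h
  refine iSup_mono fun r => EReal.sub_le_sub (mul_le_mul_of_nonneg_left h ?_) le_rfl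
  exact_mod_cast r.2

/-- This is the term `r = 1` of the supremum. It bounds the integrands of the semi-dual from below
and forces the value `⊤` at `⊤`. -/
lemma le_entropyConj (hφ : φ 1 = 0) (s : EReal) : s ≤ entropyConj φ s := by
  refine le_iSup_of_le 1 ?_
  simp [hφ]

lemma entropyConj_top (hφ : φ 1 = 0) : entropyConj φ ⊤ = ⊤ :=
  top_le_iff.1 (le_entropyConj hφ ⊤)

lemma entropyConj_ne_bot (hφ : φ 1 = 0) {s : EReal} (hs : s ≠ ⊥) : entropyConj φ s ≠ ⊥ :=
  fun h => hs (le_bot_iff.1 ((le_entropyConj hφ s).trans h.le))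

lemma coe_mul_ne_bot {a : ℝ} (ha : 0 < a) {s : EReal} (hs : s ≠ ⊥) : (a : EReal) * s ≠ ⊥ := by
  induction s using EReal.rec with
  | bot => exact absurd rfl hs
  | coe r => exact_mod_cast EReal.coe_ne_bot (a * r)
  | top => simp [EReal.coe_mul_top_of_pos ha]

lemma entropyConj_convex (hφ : φ 1 = 0) {s t : EReal} (hs : s ≠ ⊥) (ht : t ≠ ⊥) {a b : ℝ}
    (ha : 0 < a) (hb : 0 < b) (hab : a + b = 1) :
    entropyConj φ ((a : EReal) * s + (b : EReal) * t)
      ≤ (a : EReal) * entropyConj φ s + (b : EReal) * entropyConj φ t := by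
  have hs' := coe_mul_ne_bot ha (entropyConj_ne_bot hφ hs)
  have ht' := coe_mul_ne_bot hb (entropyConj_ne_bot hφ ht)
  induction s using EReal.rec with
  | bot => exact absurd rfl hs
  | top =>
    rw [entropyConj_top hφ, EReal.coe_mul_top_of_pos ha, EReal.top_add_of_ne_bot ht']
    exact le_top
  | coe s =>
    induction t using EReal.rec with
    | bot => exact absurd rfl ht
    | top =>
      rw [entropyConj_top hφ, EReal.coe_mul_top_of_pos hb, EReal.add_top_of_ne_bot hs']
      exact le_top
    | coe t =>
      refine iSup_le fun r => ?_
      rcases eq_or_ne (φ r) ⊤ with h | h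
      · simp [h]
      lift φ r to ℝ≥0 using h with p hp
      have h1 : (((r : ℝ) * s - p : ℝ) : EReal) ≤ entropyConj φ s := by
        refine le_iSup_of_le r ?_
        rw [← hp]
        exact le_of_eq (by push_cast; rfl)
      have h2 : (((r : ℝ) * t - p : ℝ) : EReal) ≤ entropyConj φ t := by
        refine le_iSup_of_le r ?_
        rw [← hp]
        exact le_of_eq (by push_cast; rfl)
      refine le_trans (le_of_eq ?_) (add_le_add
        (mul_le_mul_of_nonneg_left h1 (EReal.coe_nonneg.2 ha.le))
        (mul_le_mul_of_nonneg_left h2 (EReal.coe_nonneg.2 hb.le)))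
      have : ((p : ℝ≥0∞) : EReal) = ((p : ℝ) : EReal) := rfl
      rw [this]
      norm_cast
      obtain rfl : b = 1 - a := by linarith
      ring

lemma coe_entropyConjReal (hφ : φ 1 = 0) (hfin : ∀ s : ℝ, entropyConj φ (s : EReal) ≠ ⊤) (s : ℝ) :
    (entropyConjReal φ s : EReal) = entropyConj φ s :=
  EReal.coe_toReal (hfin s) (entropyConj_ne_bot hφ (EReal.coe_ne_bot s))

lemma entropyConjReal_mono (hφ : φ 1 = 0) (hfin : ∀ s : ℝ, entropyConj φ (s : EReal) ≠ ⊤) :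
    Monotone (entropyConjReal φ) := by
  intro s t h
  rw [← EReal.coe_le_coe_iff, coe_entropyConjReal hφ hfin, coe_entropyConjReal hφ hfin]
  exact entropyConj_mono φ (EReal.coe_le_coe_iff.2 h)

lemma entropyConjReal_convex (hφ : φ 1 = 0) (hfin : ∀ s : ℝ, entropyConj φ (s : EReal) ≠ ⊤) :
    ConvexOn ℝ univ (entropyConjReal φ) := by
  refine convexOn_iff_forall_pos.2 ⟨convex_univ, fun s _ t _ a b ha hb hab => ?_⟩
  rw [← EReal.coe_le_coe_iff, coe_entropyConjReal hφ hfin]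
  simp only [smul_eq_mul, EReal.coe_add, EReal.coe_mul, coe_entropyConjReal hφ hfin]
  exact entropyConj_convex hφ (EReal.coe_ne_bot s) (EReal.coe_ne_bot t) ha hb hab

end EntropyConj

/-! ### Extended real integrals of functions bounded below. -/

section EIntegral

variable {α : Type*} [MeasurableSpace α] {μ : Measure α}

lemma eintegral_mono_ae {f g : α → EReal} (h : f ≤ᵐ[μ] g) : eintegral μ f ≤ eintegral μ g := by
  refine EReal.sub_le_sub ?_ ?_
  · refine EReal.coe_ennreal_le_coe_ennreal_iff.2 (lintegral_mono_ae ?_)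
    filter_upwards [h] with x hx using EReal.toENNReal_le_toENNReal hx
  · refine EReal.coe_ennreal_le_coe_ennreal_iff.2 (lintegral_mono_ae ?_)
    filter_upwards [h] with x hx using EReal.toENNReal_le_toENNReal (EReal.neg_le_neg_iff.2 hx)

lemma eintegral_congr_ae {f g : α → EReal} (h : f =ᵐ[μ] g) : eintegral μ f = eintegral μ g :=
  le_antisymm (eintegral_mono_ae h.le) (eintegral_mono_ae h.symm.le)

lemma eintegral_coe {f : α → ℝ} (hf : Integrable f μ) :
    eintegral μ (fun x => (f x : EReal)) = ((∫ x, f x ∂μ : ℝ) : EReal) := by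
  rw [integral_eq_lintegral_pos_part_sub_lintegral_neg_part hf, eintegral]
  have h1 : ∫⁻ x, ENNReal.ofReal (f x) ∂μ ≠ ⊤ := hf.lintegral_lt_top.ne
  have h2 : ∫⁻ x, ENNReal.ofReal (-f x) ∂μ ≠ ⊤ := hf.neg.lintegral_lt_top.ne
  simp only [← EReal.coe_neg, EReal.real_coe_toENNReal]
  rw [EReal.coe_sub, EReal.coe_ennreal_toReal h1, EReal.coe_ennreal_toReal h2]

lemma eintegral_ne_bot [IsFiniteMeasure μ] {f : α → EReal} {C : ℝ}
    (hf : ∀ᵐ x ∂μ, (C : EReal) ≤ f x) : eintegral μ f ≠ ⊥ := by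
  have h := eintegral_mono_ae (μ := μ) (f := fun _ => (C : EReal)) (g := f) hf
  rw [eintegral_coe (integrable_const C)] at h
  intro h0
  rw [h0] at h
  exact EReal.coe_ne_bot _ (le_bot_iff.1 h)

/-- The lower bound makes the negative part integrable on a finite measure; an infinite positive
part would then force the integral to be `⊤`. So both parts are finite and real integration applies.
-/
lemma ae_eq_coe_of_eintegral_ne_top [IsFiniteMeasure μ] {f : α → EReal} {C : ℝ}
    (hf : ∀ᵐ x ∂μ, (C : EReal) ≤ f x) (hm : AEMeasurable f μ) (h : eintegral μ f ≠ ⊤) :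
    Integrable (fun x => (f x).toReal) μ ∧ ∀ᵐ x ∂μ, f x = ((f x).toReal : EReal) := by
  have hneg : ∫⁻ x, (-f x).toENNReal ∂μ ≠ ⊤ := by
    have : ∫⁻ x, (-f x).toENNReal ∂μ ≤ ∫⁻ x, ENNReal.ofReal (-C) ∂μ := by
      refine lintegral_mono_ae ?_
      filter_upwards [hf] with x hx
      rw [← EReal.real_coe_toENNReal]
      refine EReal.toENNReal_le_toENNReal ?_
      rw [EReal.coe_neg]
      exact EReal.neg_le_neg_iff.2 hx
    refine ne_top_of_le_ne_top ?_ this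
    rw [lintegral_const]
    exact ENNReal.mul_ne_top ENNReal.ofReal_ne_top (measure_ne_top _ _)
  have hpos : ∫⁻ x, (f x).toENNReal ∂μ ≠ ⊤ := by
    intro h0
    apply h
    rw [eintegral, h0, ← ENNReal.coe_toNNReal hneg]
    rfl
  have hmp : AEMeasurable (fun x => (f x).toENNReal) μ := measurable_ereal_toENNReal.comp_aemeasurable hm
  have hfin : ∀ᵐ x ∂μ, f x = ((f x).toReal : EReal) := by
    filter_upwards [ae_lt_top' hmp hpos, hf] with x hx hx'
    refine (EReal.coe_toReal ?_ ?_).symm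
    · rintro h0
      simp [h0] at hx
    · rintro h0
      rw [h0] at hx'
      exact EReal.coe_ne_bot _ (le_bot_iff.1 hx')
  refine ⟨⟨(measurable_ereal_toReal.comp_aemeasurable hm).aestronglyMeasurable, ?_⟩, hfin⟩
  rw [hasFiniteIntegral_iff_norm]
  refine lt_of_le_of_lt (lintegral_mono_ae (g := fun x => (f x).toENNReal + (-f x).toENNReal) ?_) ?_
  · filter_upwards [hfin] with x hx
    rw [hx, EReal.toReal_coe, ← EReal.coe_neg, EReal.real_coe_toENNReal, EReal.real_coe_toENNReal,
      Real.norm_eq_abs]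
    rcases abs_cases (f x).toReal with ⟨h, -⟩ | ⟨h, -⟩ <;> rw [h]
    · exact le_self_add
    · exact le_add_self
  · rw [lintegral_add_left' hmp]
    exact ENNReal.add_lt_top.2 ⟨hpos.lt_top, hneg.lt_top⟩

lemma eintegral_convex [IsFiniteMeasure μ] {f g h : α → EReal} {C : ℝ}
    (hf : ∀ᵐ x ∂μ, (C : EReal) ≤ f x) (hg : ∀ᵐ x ∂μ, (C : EReal) ≤ g x)
    (hfm : AEMeasurable f μ) (hgm : AEMeasurable g μ) {a b : ℝ} (ha : 0 < a) (hb : 0 < b)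
    (hh : ∀ᵐ x ∂μ, h x ≤ (a : EReal) * f x + (b : EReal) * g x) :
    eintegral μ h ≤ (a : EReal) * eintegral μ f + (b : EReal) * eintegral μ g := by
  have hf' := coe_mul_ne_bot ha (eintegral_ne_bot hf)
  have hg' := coe_mul_ne_bot hb (eintegral_ne_bot hg)
  by_cases h1 : eintegral μ f = ⊤
  · rw [h1, EReal.coe_mul_top_of_pos ha, EReal.top_add_of_ne_bot hg']
    exact le_top
  by_cases h2 : eintegral μ g = ⊤
  · rw [h2, EReal.coe_mul_top_of_pos hb, EReal.add_top_of_ne_bot hf']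
    exact le_top
  obtain ⟨if', ef⟩ := ae_eq_coe_of_eintegral_ne_top hf hfm h1
  obtain ⟨ig, eg⟩ := ae_eq_coe_of_eintegral_ne_top hg hgm h2
  rw [eintegral_congr_ae ef, eintegral_congr_ae eg, eintegral_coe if', eintegral_coe ig]
  refine (eintegral_mono_ae (g := fun x => ((a * (f x).toReal + b * (g x).toReal : ℝ) : EReal))
    ?_).trans ?_
  · filter_upwards [hh, ef, eg] with x hx h1 h2
    rw [h1, h2] at hx
    exact_mod_cast hx
  · have hi : Integrable (fun x => a * (f x).toReal + b * (g x).toReal) μ :=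
      (if'.const_mul a).add (ig.const_mul b)
    rw [eintegral_coe hi, integral_add (if'.const_mul a) (ig.const_mul b), integral_const_mul, integral_const_mul]
    norm_cast

end EIntegral

/-! ### Convex combinations of extended reals. -/

section ERealArith

lemma exists_coe_of_add_mul_eq_coe {a b r : ℝ} (ha : 0 < a) (hb : 0 < b) {s t : EReal}
    (hs : s ≠ ⊥) (ht : t ≠ ⊥) (h : (a : EReal) * s + (b : EReal) * t = r) :
    ∃ s' t' : ℝ, s = s' ∧ t = t' ∧ a * s' + b * t' = r := by
  have hs' := coe_mul_ne_bot ha hs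
  have ht' := coe_mul_ne_bot hb ht
  induction s using EReal.rec with
  | bot => exact absurd rfl hs
  | top =>
    rw [EReal.coe_mul_top_of_pos ha, EReal.top_add_of_ne_bot ht'] at h
    exact absurd h.symm (EReal.coe_ne_top r)
  | coe s =>
    induction t using EReal.rec with
    | bot => exact absurd rfl ht
    | top =>
      rw [EReal.coe_mul_top_of_pos hb, EReal.add_top_of_ne_bot hs'] at h
      exact absurd h.symm (EReal.coe_ne_top r)
    | coe t => exact ⟨s, t, rfl, rfl, by exact_mod_cast h⟩

lemma add_mul_sub_coe {a b : ℝ} (ha : 0 < a) (hb : 0 < b) (hab : a + b = 1) {s t : EReal}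
    (hs : s ≠ ⊥) (ht : t ≠ ⊥) (q : ℝ) :
    (a : EReal) * s + (b : EReal) * t - q = (a : EReal) * (s - q) + (b : EReal) * (t - q) := by
  induction s using EReal.rec with
  | bot => exact absurd rfl hs
  | top =>
    induction t using EReal.rec with
    | bot => exact absurd rfl ht
    | top => simp [EReal.coe_mul_top_of_pos ha, EReal.coe_mul_top_of_pos hb]
    | coe t =>
      rw [EReal.top_sub_coe, EReal.coe_mul_top_of_pos ha, ← EReal.coe_mul, EReal.top_add_coe,
        EReal.top_sub_coe, ← EReal.coe_sub, ← EReal.coe_mul, EReal.top_add_coe]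
  | coe s =>
    induction t using EReal.rec with
    | bot => exact absurd rfl ht
    | top =>
      rw [EReal.top_sub_coe, EReal.coe_mul_top_of_pos hb, ← EReal.coe_mul, EReal.coe_add_top,
        EReal.top_sub_coe, ← EReal.coe_sub, ← EReal.coe_mul, EReal.coe_add_top]
    | coe t =>
      norm_cast
      obtain rfl : b = 1 - a := by linarith
      ring

lemma sub_coe_ne_bot {s : EReal} (hs : s ≠ ⊥) (q : ℝ) : s - q ≠ ⊥ := by
  induction s using EReal.rec with
  | bot => exact absurd rfl hs
  | top => simp
  | coe s => exact EReal.coe_ne_bot (s - q)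

end ERealArith

/-! ### Fenchel conjugates. -/

section Fenchel

variable {d : ℕ} {z z₁ z₂ : EuclideanSpace ℝ (Fin d) → EReal} {x y : EuclideanSpace ℝ (Fin d)}

/-- Points where `z` is `⊤` contribute `⊥` to the supremum, so upper bounds on a conjugate reduce to
real inequalities over the domain of `z`. -/
lemma fenchel_le_coe_iff (hz : ∀ x, z x ≠ ⊥) {c : ℝ} :
    fenchel z y ≤ c ↔ ∀ x, ∀ r : ℝ, z x = r → ⟪x, y⟫ - r ≤ c := by
  rw [fenchel, iSup_le_iff]
  refine forall_congr' fun x => ⟨fun h r hr => ?_, fun h => ?_⟩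
  · rw [hr] at h
    exact_mod_cast h
  · have := hz x
    generalize z x = s at *
    induction s using EReal.rec with
    | bot => exact absurd rfl this
    | top => simp
    | coe s => exact_mod_cast h s rfl

lemma le_fenchel {r : ℝ} (h : z x = r) : ((⟪x, y⟫ - r : ℝ) : EReal) ≤ fenchel z y := by
  refine le_iSup_of_le x ?_
  rw [h]
  exact le_of_eq (EReal.coe_sub _ _)

lemma inner_sub_le_of_fenchel_eq {r c : ℝ} (h : z x = r) (hc : fenchel z y = c) :
    ⟪x, y⟫ - r ≤ c := by
  have := le_fenchel (y := y) h
  rw [hc] at this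
  exact_mod_cast this

lemma fenchel_ne_bot {r : ℝ} (h : z x = r) : fenchel z y ≠ ⊥ :=
  ne_bot_of_le_ne_bot (EReal.coe_ne_bot _) (le_fenchel h)

lemma fenchel_anti (h : ∀ x, z₁ x ≤ z₂ x) (y : EuclideanSpace ℝ (Fin d)) :
    fenchel z₂ y ≤ fenchel z₁ y :=
  iSup_mono fun x => EReal.sub_le_sub le_rfl (h x)

lemma lowerSemicontinuous_fenchel (hz : ∀ x, z x ≠ ⊥) : LowerSemicontinuous (fenchel z) := by
  refine lowerSemicontinuous_iSup fun x => ?_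
  have := hz x
  generalize z x = s at *
  induction s using EReal.rec with
  | bot => exact absurd rfl this
  | top => simpa using lowerSemicontinuous_const
  | coe s =>
    refine Continuous.lowerSemicontinuous ?_
    simp only [← EReal.coe_sub]
    exact continuous_coe_real_ereal.comp ((continuous_const.inner continuous_id).sub continuous_const)

lemma measurable_fenchel (hz : ∀ x, z x ≠ ⊥) : Measurable (fenchel z) :=
  (lowerSemicontinuous_fenchel hz).measurable

lemma fenchel_add_mul_le (hz₁ : ∀ x, z₁ x ≠ ⊥) (hz₂ : ∀ x, z₂ x ≠ ⊥) {a b : ℝ} (ha : 0 < a)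
    (hb : 0 < b) (hab : a + b = 1) (h₁ : fenchel z₁ y ≠ ⊥) (h₂ : fenchel z₂ y ≠ ⊥) :
    fenchel (fun x => (a : EReal) * z₁ x + (b : EReal) * z₂ x) y
      ≤ (a : EReal) * fenchel z₁ y + (b : EReal) * fenchel z₂ y := by
  have h₁' := coe_mul_ne_bot ha h₁
  have h₂' := coe_mul_ne_bot hb h₂
  have hw : ∀ x, (a : EReal) * z₁ x + (b : EReal) * z₂ x ≠ ⊥ := fun x =>
    EReal.add_ne_bot_iff.2 ⟨coe_mul_ne_bot ha (hz₁ x), coe_mul_ne_bot hb (hz₂ x)⟩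
  by_cases t₁ : fenchel z₁ y = ⊤
  · rw [t₁, EReal.coe_mul_top_of_pos ha, EReal.top_add_of_ne_bot h₂']
    exact le_top
  by_cases t₂ : fenchel z₂ y = ⊤
  · rw [t₂, EReal.coe_mul_top_of_pos hb, EReal.add_top_of_ne_bot h₁']
    exact le_top
  lift fenchel z₁ y to ℝ using ⟨t₁, h₁⟩ with f₁ e₁
  lift fenchel z₂ y to ℝ using ⟨t₂, h₂⟩ with f₂ e₂
  rw [← EReal.coe_mul, ← EReal.coe_mul, ← EReal.coe_add, fenchel_le_coe_iff hw]
  intro x r hr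
  obtain ⟨s, t, hs, ht, rfl⟩ := exists_coe_of_add_mul_eq_coe ha hb (hz₁ x) (hz₂ x) hr
  have h1 := inner_sub_le_of_fenchel_eq hs e₁.symm
  have h2 := inner_sub_le_of_fenchel_eq ht e₂.symm
  obtain rfl : b = 1 - a := by linarith
  nlinarith [mul_le_mul_of_nonneg_left h1 ha.le, mul_le_mul_of_nonneg_left h2 hb.le]

lemma fenchel_convex (hz : ∀ x, z x ≠ ⊥) {a b : ℝ} (ha : 0 < a) (hb : 0 < b) (hab : a + b = 1)
    {y y' : EuclideanSpace ℝ (Fin d)} {f f' : ℝ} (h : fenchel z y = f) (h' : fenchel z y' = f') :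
    fenchel z (a • y + b • y') ≤ ((a * f + b * f' : ℝ) : EReal) := by
  rw [fenchel_le_coe_iff hz]
  intro x r hr
  have h1 := inner_sub_le_of_fenchel_eq hr h
  have h2 := inner_sub_le_of_fenchel_eq hr h'
  rw [inner_add_right, inner_smul_right, inner_smul_right]
  obtain rfl : b = 1 - a := by linarith
  nlinarith [mul_le_mul_of_nonneg_left h1 ha.le, mul_le_mul_of_nonneg_left h2 hb.le]

end Fenchel

/-! ### Admissible functions and convexity of the semi-dual. -/

section Admissible

variable {d : ℕ} {X : Set (EuclideanSpace ℝ (Fin d))} {z z₁ z₂ : EuclideanSpace ℝ (Fin d) → EReal}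
  {φ : ℝ≥0 → ℝ≥0∞} {μ ν : Measure (EuclideanSpace ℝ (Fin d))}

lemma continuous_quad : Continuous (quad : EuclideanSpace ℝ (Fin d) → ℝ) := by
  unfold quad
  fun_prop

lemma IsAdmissible.coe_toReal (hz : IsAdmissible X z) {x : EuclideanSpace ℝ (Fin d)} (hx : x ∈ X) :
    ((z x).toReal : EReal) = z x := EReal.coe_toReal (hz.ne_top x hx) (hz.ne_bot x)

lemma IsAdmissible.continuousOn_toReal (hz : IsAdmissible X z) :
    ContinuousOn (fun x => (z x).toReal) X :=
  EReal.continuousOn_toReal.comp hz.continuousOn fun x hx => by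
    simp [hz.ne_bot x, hz.ne_top x hx]

lemma IsAdmissible.exists_bound (hz : IsAdmissible X z) (hX : IsCompact X) :
    ∃ C : ℝ, ∀ x ∈ X, |(z x).toReal - quad x| ≤ C :=
  hX.exists_bound_of_continuousOn (hz.continuousOn_toReal.sub continuous_quad.continuousOn)

/-- A single point of `X` gives an affine minorant of the conjugate, which is bounded below on the
compact set `Y`. -/
lemma IsAdmissible.exists_fenchel_lower_bound (hz : IsAdmissible X z) (hXne : X.Nonempty)
    {Y : Set (EuclideanSpace ℝ (Fin d))} (hY : IsCompact Y) :
    ∃ C : ℝ, ∀ y ∈ Y, (C : EReal) ≤ fenchel z y - quad y := by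
  obtain ⟨x, hx⟩ := hXne
  have hc : Continuous fun y => ⟪x, y⟫ - (z x).toReal - quad y :=
    ((continuous_const.inner continuous_id).sub continuous_const).sub continuous_quad
  obtain ⟨C, hC⟩ := hY.exists_bound_of_continuousOn hc.continuousOn
  refine ⟨-C, fun y hy => ?_⟩
  have h1 := (abs_le.1 (hC y hy)).1
  refine (EReal.coe_le_coe_iff.2 h1).trans ?_
  rw [EReal.coe_sub]
  exact EReal.sub_le_sub (le_fenchel (hz.coe_toReal hx).symm) le_rfl

lemma IsAdmissible.fenchel_ne_bot (hz : IsAdmissible X z) (hXne : X.Nonempty)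
    (y : EuclideanSpace ℝ (Fin d)) : fenchel z y ≠ ⊥ := by
  obtain ⟨x, hx⟩ := hXne
  exact UOT.fenchel_ne_bot (hz.coe_toReal hx).symm

lemma IsAdmissible.aemeasurable (hz : IsAdmissible X z) (hX : IsCompact X) (hμ : μ Xᶜ = 0) :
    AEMeasurable z μ := by
  have := hz.continuousOn.aemeasurable (μ := μ) hX.measurableSet
  rwa [Measure.restrict_eq_self_of_ae_mem (mem_ae_iff.2 hμ)] at this

lemma aemeasurable_entropyConj_sub {ρ : Measure (EuclideanSpace ℝ (Fin d))}
    (hz : AEMeasurable z ρ) :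
    AEMeasurable (fun x => entropyConj φ (z x - (quad x : EReal))) ρ :=
  (entropyConj_mono φ).measurable.comp_aemeasurable
    (hz.sub continuous_quad.measurable.coe_real_ereal.aemeasurable)

lemma IsAdmissible.exists_entropyConj_bounds (hφ : φ 1 = 0) (hz : IsAdmissible X z)
    (hX : IsCompact X) (hXne : X.Nonempty) {Y : Set (EuclideanSpace ℝ (Fin d))} (hY : IsCompact Y)
    (hμ : μ Xᶜ = 0) (hν : ν Yᶜ = 0) :
    ∃ C : ℝ, (∀ᵐ x ∂μ, (C : EReal) ≤ entropyConj φ (z x - (quad x : EReal))) ∧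
      ∀ᵐ y ∂ν, (C : EReal) ≤ entropyConj φ (fenchel z y - (quad y : EReal)) := by
  obtain ⟨C₁, h₁⟩ := hz.exists_bound hX
  obtain ⟨C₂, h₂⟩ := hz.exists_fenchel_lower_bound hXne hY
  refine ⟨min (-C₁) C₂, ?_, ?_⟩
  · filter_upwards [mem_ae_iff.2 hμ] with x hx
    refine le_trans ?_ (le_entropyConj hφ _)
    rw [← hz.coe_toReal hx, ← EReal.coe_sub, EReal.coe_le_coe_iff]
    exact (min_le_left _ _).trans (abs_le.1 (h₁ x hx)).1
  · filter_upwards [mem_ae_iff.2 hν] with y hy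
    refine le_trans ?_ (le_entropyConj hφ _)
    exact (EReal.coe_le_coe_iff.2 (min_le_right _ _)).trans (h₂ y hy)

lemma semiDual_convex (hφ : φ 1 = 0) (hX : IsCompact X) (hXne : X.Nonempty)
    {Y : Set (EuclideanSpace ℝ (Fin d))} (hY : IsCompact Y) [IsFiniteMeasure μ] [IsFiniteMeasure ν]
    (hμ : μ Xᶜ = 0) (hν : ν Yᶜ = 0) (h₁ : IsAdmissible X z₁) (h₂ : IsAdmissible X z₂) {a b : ℝ}
    (ha : 0 ≤ a) (hb : 0 ≤ b) (hab : a + b = 1) :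
    semiDual φ μ ν (fun x => (a : EReal) * z₁ x + (b : EReal) * z₂ x)
      ≤ (a : EReal) * semiDual φ μ ν z₁ + (b : EReal) * semiDual φ μ ν z₂ := by
  rcases ha.eq_or_lt with rfl | ha
  · obtain rfl : b = 1 := by linarith
    simp
  rcases hb.eq_or_lt with rfl | hb
  · obtain rfl : a = 1 := by linarith
    simp
  obtain ⟨C₁, m₁, n₁⟩ := h₁.exists_entropyConj_bounds hφ hX hXne hY hμ hν
  obtain ⟨C₂, m₂, n₂⟩ := h₂.exists_entropyConj_bounds hφ hX hXne hY hμ hν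
  have le₁ : ((min C₁ C₂ : ℝ) : EReal) ≤ C₁ := EReal.coe_le_coe_iff.2 (min_le_left _ _)
  have le₂ : ((min C₁ C₂ : ℝ) : EReal) ≤ C₂ := EReal.coe_le_coe_iff.2 (min_le_right _ _)
  have hM : eintegral μ (fun x => entropyConj φ ((a : EReal) * z₁ x + (b : EReal) * z₂ x
        - (quad x : EReal))) ≤ _ :=
    eintegral_convex (m₁.mono fun _ h => le₁.trans h) (m₂.mono fun _ h => le₂.trans h)
    (aemeasurable_entropyConj_sub (h₁.aemeasurable hX hμ))
    (aemeasurable_entropyConj_sub (h₂.aemeasurable hX hμ)) ha hb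
    (Eventually.of_forall fun x => by
      rw [add_mul_sub_coe ha hb hab (h₁.ne_bot x) (h₂.ne_bot x)]
      exact entropyConj_convex hφ (sub_coe_ne_bot (h₁.ne_bot x) _) (sub_coe_ne_bot (h₂.ne_bot x) _)
        ha hb hab)
  have hN : eintegral ν (fun y => entropyConj φ
        (fenchel (fun x => (a : EReal) * z₁ x + (b : EReal) * z₂ x) y - (quad y : EReal))) ≤ _ :=
    eintegral_convex (n₁.mono fun _ h => le₁.trans h) (n₂.mono fun _ h => le₂.trans h)
    (aemeasurable_entropyConj_sub (measurable_fenchel h₁.ne_bot).aemeasurable)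
    (aemeasurable_entropyConj_sub (measurable_fenchel h₂.ne_bot).aemeasurable) ha hb
    (Eventually.of_forall fun y => by
      have b₁ := h₁.fenchel_ne_bot hXne y
      have b₂ := h₂.fenchel_ne_bot hXne y
      refine le_trans (entropyConj_mono φ (EReal.sub_le_sub
        (fenchel_add_mul_le h₁.ne_bot h₂.ne_bot ha hb hab b₁ b₂) le_rfl)) ?_
      rw [add_mul_sub_coe ha hb hab b₁ b₂]
      exact entropyConj_convex hφ (sub_coe_ne_bot b₁ _) (sub_coe_ne_bot b₂ _) ha hb hab)
  refine (add_le_add hM hN).trans (le_of_eq ?_)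
  rw [semiDual, semiDual,
    EReal.left_distrib_of_nonneg_of_ne_top (EReal.coe_nonneg.2 ha.le) (EReal.coe_ne_top a),
    EReal.left_distrib_of_nonneg_of_ne_top (EReal.coe_nonneg.2 hb.le) (EReal.coe_ne_top b),
    add_add_add_comm]

end Admissible

end UOT

/-! ### Strongly convex functions, differentiability of their conjugates, and truncation. -/

namespace UOT

variable {d : ℕ} {z z₁ z₂ : EuclideanSpace ℝ (Fin d) → EReal} {m : ℝ}

lemma StronglyConvex.exists_coe (hz : ∀ x, z x ≠ ⊥) (hc : StronglyConvex m z)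
    {x y : EuclideanSpace ℝ (Fin d)} {r s a b : ℝ} (hx : z x = r) (hy : z y = s) (ha : 0 ≤ a)
    (hb : 0 ≤ b) (hab : a + b = 1) :
    ∃ t : ℝ, z (a • x + b • y) = t ∧ t + m / 2 * (a * b) * ‖x - y‖ ^ 2 ≤ a * r + b * s := by
  have h := hc x y a b ha hb hab
  have hb' := hz (a • x + b • y)
  rw [hx, hy] at h
  generalize z (a • x + b • y) = w at *
  induction w using EReal.rec with
  | bot => exact absurd rfl hb'
  | top =>
    rw [EReal.top_add_coe, top_le_iff, ← EReal.coe_mul, ← EReal.coe_mul, ← EReal.coe_add] at h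
    exact absurd h (EReal.coe_ne_top _)
  | coe t => exact ⟨t, rfl, by exact_mod_cast h⟩

lemma stronglyConvex_of_coe (hz : ∀ x, z x ≠ ⊥)
    (h : ∀ x y : EuclideanSpace ℝ (Fin d), ∀ r s a b : ℝ, z x = r → z y = s → 0 < a → 0 < b →
      a + b = 1 → z (a • x + b • y) ≤ ((a * r + b * s - m / 2 * (a * b) * ‖x - y‖ ^ 2 : ℝ) : EReal)) :
    StronglyConvex m z := by
  intro x y a b ha hb hab
  rcases ha.eq_or_lt with rfl | ha
  · obtain rfl : b = 1 := by linarith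
    simp
  rcases hb.eq_or_lt with rfl | hb
  · obtain rfl : a = 1 := by linarith
    simp
  have bx := hz x
  have b_y := hz y
  by_cases tx : z x = ⊤
  · rw [tx, EReal.coe_mul_top_of_pos ha, EReal.top_add_of_ne_bot (coe_mul_ne_bot hb b_y)]
    exact le_top
  by_cases ty : z y = ⊤
  · rw [ty, EReal.coe_mul_top_of_pos hb, EReal.add_top_of_ne_bot (coe_mul_ne_bot ha bx)]
    exact le_top
  have ex := (EReal.coe_toReal tx bx).symm
  have ey := (EReal.coe_toReal ty b_y).symm
  have := h x y _ _ a b ex ey ha hb hab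
  rw [ex, ey, ← EReal.coe_mul, ← EReal.coe_mul, ← EReal.coe_add]
  refine (add_le_add_left this _).trans (le_of_eq ?_)
  norm_cast
  ring

/-- The domain of `z` may have empty interior. Inside the linear span of its translate by `-x₁` it
does have interior, and there a finite convex function is continuous; off that span `z` is `⊤`. -/
lemma StronglyConvex.exists_local_lower_bound (hz : ∀ x, z x ≠ ⊥) (hc : StronglyConvex 0 z)
    {x₁ : EuclideanSpace ℝ (Fin d)} (h₁ : z x₁ ≠ ⊤) :
    ∃ p, z p ≠ ⊤ ∧ ∃ δ > 0, ∃ K : ℝ, ∀ x, ‖x - p‖ ≤ δ → (K : EReal) ≤ z x := by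
  set S : Set (EuclideanSpace ℝ (Fin d)) := {v | z (x₁ + v) ≠ ⊤} with hS
  set C : Set (Submodule.span ℝ S) := (↑) ⁻¹' S with hC
  have h0 : (0 : Submodule.span ℝ S) ∈ C := by simpa [hC, hS] using h₁
  have key : ∀ u v : EuclideanSpace ℝ (Fin d), u ∈ S → v ∈ S → ∀ a b : ℝ, 0 ≤ a → 0 ≤ b →
      a + b = 1 → (a • u + b • v) ∈ S ∧ (z (x₁ + (a • u + b • v))).toReal
        ≤ a * (z (x₁ + u)).toReal + b * (z (x₁ + v)).toReal := by
    intro u v hu hv a b ha hb hab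
    obtain ⟨t, ht, hle⟩ := hc.exists_coe hz (EReal.coe_toReal hu (hz _)).symm
      (EReal.coe_toReal hv (hz _)).symm ha hb hab
    have e : a • (x₁ + u) + b • (x₁ + v) = x₁ + (a • u + b • v) := by
      rw [smul_add, smul_add, add_add_add_comm, ← add_smul, hab, one_smul]
    rw [e] at ht
    constructor
    · simp [hS, ht]
    · rw [ht, EReal.toReal_coe]
      simpa using hle
  have hconv : ConvexOn ℝ C (fun v => (z (x₁ + v)).toReal) := by
    refine ⟨fun u hu v hv a b ha hb hab => ?_, fun u hu v hv a b ha hb hab => ?_⟩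
    · exact (key u v hu hv a b ha hb hab).1
    · exact (key u v hu hv a b ha hb hab).2
  -- Since `C` contains `0`, its direction space is its linear span, which is everything by
  -- construction.
  have hspan : affineSpan ℝ C = ⊤ := by
    rw [AffineSubspace.affineSpan_eq_top_iff_vectorSpan_eq_top_of_nonempty ℝ _ _ ⟨0, h0⟩,
      vectorSpan_eq_span_vsub_set_right ℝ h0]
    simp only [vsub_eq_sub, sub_zero, image_id']
    exact Submodule.span_span_coe_preimage
  obtain ⟨p, hp⟩ := hconv.1.interior_nonempty_iff_affineSpan_eq_top.2 hspan
  have hcont := hconv.continuousOn_interior.continuousAt (isOpen_interior.mem_nhds hp)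
  have hev := hcont.eventually (lt_mem_nhds (sub_one_lt _))
  obtain ⟨δ, hδ, hball⟩ := Metric.eventually_nhds_iff.1 hev
  refine ⟨x₁ + p, interior_subset hp, δ / 2, half_pos hδ, (z (x₁ + p)).toReal - 1, fun x hx => ?_⟩
  by_cases hxt : z x = ⊤
  · simp [hxt]
  have hxS : x - x₁ ∈ S := by simpa [hS] using hxt
  have hmem : x - x₁ ∈ Submodule.span ℝ S := Submodule.subset_span hxS
  have := hball (y := ⟨x - x₁, hmem⟩) (by
    rw [dist_eq_norm]
    change ‖x - x₁ - (p : EuclideanSpace ℝ (Fin d))‖ < δ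
    rw [sub_sub]
    linarith)
  rw [← EReal.coe_toReal hxt (hz x), EReal.coe_le_coe_iff]
  simpa using this.le

/-- Outside the ball of radius `δ`, the segment from `p` to `x` meets its boundary, where `z ≥ K`.
Strong convexity along the segment, solved for `z x`, gives quadratic growth with a linear error.
The case `m = 0` serves the truncation of merely convex functions. -/
lemma StronglyConvex.exists_lower_bound (hz : ∀ x, z x ≠ ⊥) (hm : 0 ≤ m) (h0 : StronglyConvex 0 z)
    (hc : StronglyConvex m z) {x₁ : EuclideanSpace ℝ (Fin d)} (h₁ : z x₁ ≠ ⊤) :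
    ∃ p : EuclideanSpace ℝ (Fin d), ∃ A B : ℝ, 0 ≤ B ∧ ∀ x, ∀ r : ℝ, z x = r →
      m / 2 * ‖x - p‖ ^ 2 - B * ‖x - p‖ - A ≤ r := by
  obtain ⟨p, hp, δ, hδ, K, hK⟩ := h0.exists_local_lower_bound hz h₁
  have hp := (EReal.coe_toReal hp (hz p)).symm
  set q := (z p).toReal
  refine ⟨p, |q| + |K| + m / 2 * δ ^ 2, |K / δ - q / δ - m / 2 * δ|, abs_nonneg _, fun x r hr => ?_⟩
  have hρ : 0 ≤ ‖x - p‖ := norm_nonneg _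
  rcases le_or_gt ‖x - p‖ δ with h | h
  · have h2 := hK x h
    rw [hr, EReal.coe_le_coe_iff] at h2
    have h3 : ‖x - p‖ ^ 2 ≤ δ ^ 2 := by gcongr
    have h4 : m / 2 * ‖x - p‖ ^ 2 ≤ m / 2 * δ ^ 2 := by gcongr
    have h5 := mul_nonneg (abs_nonneg (K / δ - q / δ - m / 2 * δ)) hρ
    linarith [neg_abs_le K, abs_nonneg q]
  · have hpos := hδ.trans h
    set ρ := ‖x - p‖ with hρd
    have ht : 0 < δ / ρ := div_pos hδ hpos
    have ht1 : δ / ρ < 1 := (div_lt_one hpos).2 h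
    obtain ⟨s, hs, hle⟩ := hc.exists_coe hz hr hp ht.le (sub_nonneg.2 ht1.le) (by ring)
    have h2 := hK ((δ / ρ) • x + (1 - δ / ρ) • p) (by
      have : (δ / ρ) • x + (1 - δ / ρ) • p - p = (δ / ρ) • (x - p) := by module
      rw [this, norm_smul, Real.norm_of_nonneg ht.le, ← hρd, div_mul_cancel₀ _ hpos.ne'])
    rw [hs, EReal.coe_le_coe_iff] at h2
    have h3 : K + m / 2 * (δ / ρ * (1 - δ / ρ)) * ρ ^ 2 ≤ δ / ρ * r + (1 - δ / ρ) * q := by linarith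
    -- Multiplication by `ρ / δ` isolates `r`; the coefficient of `ρ` that appears is the quantity
    -- whose absolute value was chosen as `B`.
    have h4 := mul_le_mul_of_nonneg_left h3 (div_pos hpos hδ).le
    have e1 : ρ / δ * (K + m / 2 * (δ / ρ * (1 - δ / ρ)) * ρ ^ 2)
        = ρ * (K / δ) + m / 2 * ρ ^ 2 - m / 2 * δ * ρ := by
      field_simp
      ring
    have e2 : ρ / δ * (δ / ρ * r + (1 - δ / ρ) * q) = r + ρ * (q / δ) - q := by
      field_simp
      ring
    rw [e1, e2] at h4
    have h5 := mul_le_mul_of_nonneg_right (neg_abs_le (K / δ - q / δ - m / 2 * δ)) hρ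
    have h6 : 0 ≤ m / 2 * δ ^ 2 := by positivity
    nlinarith [neg_abs_le q, abs_nonneg K]

/-- Quadratic growth beats the linear terms; the bound is the maximum of `(‖y‖ + B) ρ - m/2 ρ²` over
`ρ`. -/
lemma StronglyConvex.fenchel_ne_top (hz : ∀ x, z x ≠ ⊥) (hm : 0 < m) (h0 : StronglyConvex 0 z)
    (hc : StronglyConvex m z) {x₁ : EuclideanSpace ℝ (Fin d)} (h₁ : z x₁ ≠ ⊤)
    (y : EuclideanSpace ℝ (Fin d)) : fenchel z y ≠ ⊤ := by
  obtain ⟨p, A, B, hB, h⟩ := StronglyConvex.exists_lower_bound hz hm.le h0 hc h₁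
  have : fenchel z y ≤ ((‖p‖ * ‖y‖ + A + (‖y‖ + B) ^ 2 / (2 * m) : ℝ) : EReal) := by
    rw [fenchel_le_coe_iff hz]
    intro x r hr
    have h1 := h x r hr
    have h2 := real_inner_le_norm x y
    have h3 : ‖x‖ ≤ ‖x - p‖ + ‖p‖ := norm_le_norm_sub_add x p
    have h4 := mul_le_mul_of_nonneg_right h3 (norm_nonneg y)
    have h5 : (‖y‖ + B) * ‖x - p‖ - m / 2 * ‖x - p‖ ^ 2 ≤ (‖y‖ + B) ^ 2 / (2 * m) := by
      rw [le_div_iff₀ (by positivity)]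
      nlinarith [sq_nonneg (m * ‖x - p‖ - (‖y‖ + B))]
    nlinarith
  exact ne_top_of_le_ne_top (EReal.coe_ne_top _) this

lemma exists_lt_of_lt_fenchel (hz : ∀ x, z x ≠ ⊥) {y : EuclideanSpace ℝ (Fin d)} {c : ℝ}
    (hc : (c : EReal) < fenchel z y) : ∃ x, ∃ r : ℝ, z x = r ∧ c < ⟪x, y⟫ - r := by
  by_contra! h
  exact absurd ((fenchel_le_coe_iff hz).2 h) hc.not_ge

/-- The conjugate of a strongly convex function is attained quantitatively. -/
lemma StronglyConvex.exists_maximizer (hz : ∀ x, z x ≠ ⊥) (hm : 0 < m)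
    (hc : StronglyConvex m z) {y : EuclideanSpace ℝ (Fin d)} {f : ℝ} (hf : fenchel z y = f) :
    ∃ S : EuclideanSpace ℝ (Fin d),
      (∀ y' f', fenchel z y' = ((f' : ℝ) : EReal) → f + ⟪S, y' - y⟫ ≤ f') ∧
      ∀ x, ∀ r : ℝ, z x = r → ⟪x, y⟫ - r ≤ f - m / 2 * ‖x - S‖ ^ 2 := by
  have hseq : ∀ n : ℕ, ∃ x, ∃ r : ℝ, z x = r ∧ f - 1 / ((n : ℝ) + 1) < ⟪x, y⟫ - r := fun n =>
    exists_lt_of_lt_fenchel hz (by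
      rw [hf, EReal.coe_lt_coe_iff]
      exact sub_lt_self _ Nat.one_div_pos_of_nat)
  choose x r hxr hlt using hseq
  have hgen : ∀ u v : EuclideanSpace ℝ (Fin d), ∀ p q a b : ℝ, z u = p → z v = q → 0 ≤ a → 0 ≤ b →
      a + b = 1 → a * (⟪u, y⟫ - p) + b * (⟪v, y⟫ - q) + m / 2 * (a * b) * ‖u - v‖ ^ 2 ≤ f := by
    intro u v p q a b hu hv ha hb hab
    obtain ⟨t, ht, hle⟩ := hc.exists_coe hz hu hv ha hb hab
    have := inner_sub_le_of_fenchel_eq ht hf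
    rw [inner_add_left, real_inner_smul_left, real_inner_smul_left] at this
    linarith
  -- At the midpoint of two near-maximizers the strong concavity gain is `m/8 ‖x n - x k‖²`, which
  -- the tolerance `1 / (n + 1)` must absorb.
  have hcau : CauchySeq x := by
    refine cauchySeq_of_le_tendsto_0' (fun n : ℕ => √(8 / m * (1 / ((n : ℝ) + 1)))) ?_ ?_
    · intro n k hnk
      rw [dist_eq_norm]
      apply Real.le_sqrt_of_sq_le
      have h1 := hgen _ _ _ _ (1 / 2) (1 / 2) (hxr n) (hxr k) (by norm_num) (by norm_num)
        (by norm_num)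
      have h2 := hlt n
      have h3 := hlt k
      have h4 : 1 / ((k : ℝ) + 1) ≤ 1 / ((n : ℝ) + 1) := Nat.one_div_le_one_div hnk
      have h5 : m / 8 * ‖x n - x k‖ ^ 2 ≤ 1 / ((n : ℝ) + 1) := by nlinarith
      calc ‖x n - x k‖ ^ 2 = 8 / m * (m / 8 * ‖x n - x k‖ ^ 2) := by field_simp
        _ ≤ _ := by gcongr
    · have : Tendsto (fun n : ℕ => √(8 / m * (1 / ((n : ℝ) + 1)))) atTop (𝓝 √(8 / m * 0)) :=
        (tendsto_one_div_add_atTop_nhds_zero_nat.const_mul _).sqrt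
      simpa using this
  -- Without lower semicontinuity of `z` the supremum need not be attained at `S`, so both claims
  -- are obtained as limits along the near-maximizers.
  obtain ⟨S, hS⟩ := cauchySeq_tendsto_of_complete hcau
  refine ⟨S, fun y' f' hf' => ?_, fun v q hv => ?_⟩
  · have hlim : Tendsto (fun n : ℕ => f - 1 / ((n : ℝ) + 1) + ⟪x n, y' - y⟫) atTop
        (𝓝 (f - 0 + ⟪S, y' - y⟫)) :=
      (tendsto_const_nhds.sub tendsto_one_div_add_atTop_nhds_zero_nat).add
        (hS.inner tendsto_const_nhds)
    rw [sub_zero] at hlim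
    refine le_of_tendsto' hlim fun n => ?_
    have := inner_sub_le_of_fenchel_eq (hxr n) hf'
    rw [inner_sub_right]
    linarith [hlt n]
  · have hstep : ∀ a : ℝ, 0 < a → a < 1 →
        ⟪v, y⟫ - q + m / 2 * (1 - a) * ‖v - S‖ ^ 2 ≤ f := by
      intro a ha ha1
      have hlim : Tendsto (fun n : ℕ => a * (⟪v, y⟫ - q) + (1 - a) * (f - 1 / ((n : ℝ) + 1))
          + m / 2 * (a * (1 - a)) * ‖v - x n‖ ^ 2) atTop
          (𝓝 (a * (⟪v, y⟫ - q) + (1 - a) * (f - 0) + m / 2 * (a * (1 - a)) * ‖v - S‖ ^ 2)) :=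
        (tendsto_const_nhds.add ((tendsto_const_nhds.sub
          tendsto_one_div_add_atTop_nhds_zero_nat).const_mul _)).add
          (((tendsto_const_nhds.sub hS).norm.pow 2).const_mul _)
      have h1 := le_of_tendsto' (b := f) hlim fun n => by
        have h2 := hgen _ _ _ _ a (1 - a) hv (hxr n) ha.le (by linarith) (by ring)
        have h3 := mul_le_mul_of_nonneg_left (hlt n).le (sub_nonneg.2 ha1.le)
        linarith
      have h2 : a * (⟪v, y⟫ - q + m / 2 * (1 - a) * ‖v - S‖ ^ 2) ≤ a * f := by linarith
      exact le_of_mul_le_mul_left h2 ha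
    have hlim : Tendsto (fun a : ℝ => ⟪v, y⟫ - q + m / 2 * (1 - a) * ‖v - S‖ ^ 2) (𝓝[>] 0)
        (𝓝 (⟪v, y⟫ - q + m / 2 * (1 - 0) * ‖v - S‖ ^ 2)) := by
      refine Tendsto.mono_left (Continuous.tendsto ?_ 0) nhdsWithin_le_nhds
      fun_prop
    have := le_of_tendsto hlim (by
      filter_upwards [Ioo_mem_nhdsGT (zero_lt_one' ℝ)] with a ha using hstep a ha.1 ha.2)
    linarith

/-- The limit `S` of near-maximizers is a subgradient, and completing the square gives the upper
bound `f y + ⟪S, y' - y⟫ + ‖y' - y‖² / (2m)`. The remainder is thus quadratic. -/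
lemma StronglyConvex.hasGradientAt_fenchel (hz : ∀ x, z x ≠ ⊥) (hm : 0 < m)
    (hc : StronglyConvex m z) {f : EuclideanSpace ℝ (Fin d) → ℝ} (hf : ∀ y, fenchel z y = f y)
    (y : EuclideanSpace ℝ (Fin d)) :
    ∃ S : EuclideanSpace ℝ (Fin d), HasGradientAt f S y ∧
      ∀ x, ∀ r : ℝ, z x = r → ⟪x, y⟫ - r ≤ f y - m / 2 * ‖x - S‖ ^ 2 := by
  obtain ⟨S, h1, h2⟩ := hc.exists_maximizer hz hm (hf y)
  refine ⟨S, ?_, h2⟩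
  have hup : ∀ y', f y' ≤ f y + ⟪S, y' - y⟫ + ‖y' - y‖ ^ 2 / (2 * m) := by
    intro y'
    rw [← EReal.coe_le_coe_iff, ← hf y', fenchel_le_coe_iff hz]
    intro x r hr
    have h3 := h2 x r hr
    have h4 := real_inner_le_norm (x - S) (y' - y)
    have h5 : ‖x - S‖ * ‖y' - y‖ - m / 2 * ‖x - S‖ ^ 2 ≤ ‖y' - y‖ ^ 2 / (2 * m) := by
      rw [le_div_iff₀ (by positivity)]
      nlinarith [sq_nonneg (m * ‖x - S‖ - ‖y' - y‖)]
    have h6 : ⟪x - S, y' - y⟫ = ⟪x, y'⟫ - ⟪x, y⟫ - ⟪S, y' - y⟫ := by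
      rw [inner_sub_left, inner_sub_right x]
    linarith
  rw [hasGradientAt_iff_isLittleO]
  refine Asymptotics.IsBigO.trans_isLittleO (g := fun y' => ‖y' - y‖ ^ 2) ?_ ?_
  · refine Asymptotics.IsBigO.of_bound (1 / (2 * m)) (Eventually.of_forall fun y' => ?_)
    have h3 := h1 y' _ (hf y')
    have h4 := hup y'
    have e : ‖y' - y‖ ^ 2 / (2 * m) = 1 / (2 * m) * ‖y' - y‖ ^ 2 := by ring
    rw [Real.norm_of_nonneg (by linarith), Real.norm_of_nonneg (by positivity), ← e]
    linarith
  · simpa using Asymptotics.isLittleO_pow_sub_sub y (m := 2) one_lt_two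

/-- The restriction of `z` to the closed ball of radius `R`. -/
noncomputable def truncate (R : ℝ) (z : EuclideanSpace ℝ (Fin d) → EReal) (x : EuclideanSpace ℝ (Fin d)) :
    EReal :=
  open Classical in if ‖x‖ ≤ R then z x else ⊤

lemma truncate_of_le {R : ℝ} {x : EuclideanSpace ℝ (Fin d)} (h : ‖x‖ ≤ R) :
    truncate R z x = z x := if_pos h

lemma truncate_eq_coe {R r : ℝ} {x : EuclideanSpace ℝ (Fin d)} (h : truncate R z x = r) :
    ‖x‖ ≤ R ∧ z x = r := by
  unfold truncate at h
  split_ifs at h with h1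
  · exact ⟨h1, h⟩
  · exact absurd h.symm (EReal.coe_ne_top r)

lemma truncate_ne_bot {R : ℝ} (hz : ∀ x, z x ≠ ⊥) (x : EuclideanSpace ℝ (Fin d)) :
    truncate R z x ≠ ⊥ := by
  unfold truncate
  split_ifs
  · exact hz x
  · simp

lemma le_truncate (R : ℝ) (x : EuclideanSpace ℝ (Fin d)) : z x ≤ truncate R z x := by
  unfold truncate
  split_ifs <;> simp

lemma stronglyConvex_truncate {R : ℝ} (hz : ∀ x, z x ≠ ⊥) (hc : StronglyConvex 0 z) :
    StronglyConvex 0 (truncate R z) := by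
  refine stronglyConvex_of_coe (truncate_ne_bot hz) fun x y r s a b hx hy ha hb hab => ?_
  obtain ⟨hx, ex⟩ := truncate_eq_coe hx
  obtain ⟨hy, ey⟩ := truncate_eq_coe hy
  have h : ‖a • x + b • y‖ ≤ R := by
    refine (norm_add_le _ _).trans ?_
    rw [norm_smul, norm_smul, Real.norm_of_nonneg ha.le, Real.norm_of_nonneg hb.le]
    calc a * ‖x‖ + b * ‖y‖ ≤ a * R + b * R := by gcongr
      _ = R := by rw [← add_mul, hab, one_mul]
  obtain ⟨t, ht, hle⟩ := hc.exists_coe hz ex ey ha.le hb.le hab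
  rw [truncate_of_le h, ht, EReal.coe_le_coe_iff]
  linarith

/-- On a ball, the lower bound with `m = 0` keeps `z` above a constant. -/
lemma fenchel_truncate_ne_top {R : ℝ} (hz : ∀ x, z x ≠ ⊥) (hc : StronglyConvex 0 z)
    {x₁ : EuclideanSpace ℝ (Fin d)} (h₁ : z x₁ ≠ ⊤) (y : EuclideanSpace ℝ (Fin d)) :
    fenchel (truncate R z) y ≠ ⊤ := by
  obtain ⟨p, A, B, hB, h⟩ := StronglyConvex.exists_lower_bound hz le_rfl hc hc h₁
  have : fenchel (truncate R z) y ≤ ((R * ‖y‖ + B * (R + ‖p‖) + A : ℝ) : EReal) := by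
    rw [fenchel_le_coe_iff (truncate_ne_bot hz)]
    intro x r hr
    obtain ⟨hx, hr⟩ := truncate_eq_coe hr
    have h1 := h x r hr
    have h2 := real_inner_le_norm x y
    have h3 := norm_sub_le x p
    have h4 := mul_le_mul_of_nonneg_right hx (norm_nonneg y)
    have h5 := mul_le_mul_of_nonneg_left (h3.trans (add_le_add_left hx ‖p‖)) hB
    linarith
  exact ne_top_of_le_ne_top (EReal.coe_ne_top _) this

lemma isPotential_truncate {X : Set (EuclideanSpace ℝ (Fin d))} {R : ℝ} (hR : ∀ x ∈ X, ‖x‖ ≤ R)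
    (hz : IsPotential X z) : IsPotential X (truncate R z) :=
  ⟨⟨truncate_ne_bot hz.1.ne_bot, fun x hx => by
      rw [truncate_of_le (hR x hx)]
      exact hz.1.ne_top x hx,
    hz.1.continuousOn.congr fun x hx => truncate_of_le (hR x hx)⟩,
    stronglyConvex_truncate hz.1.ne_bot hz.2⟩

lemma isPotential_add_mul {X : Set (EuclideanSpace ℝ (Fin d))} (h₁ : IsPotential X z₁)
    (h₂ : IsPotential X z₂) {a b : ℝ} (ha : 0 < a) (hb : 0 < b) :
    IsPotential X (fun x => (a : EReal) * z₁ x + (b : EReal) * z₂ x) := by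
  have hw : ∀ x, (a : EReal) * z₁ x + (b : EReal) * z₂ x ≠ ⊥ := fun x =>
    EReal.add_ne_bot_iff.2 ⟨coe_mul_ne_bot ha (h₁.1.ne_bot x), coe_mul_ne_bot hb (h₂.1.ne_bot x)⟩
  have he : ∀ x ∈ X, (a : EReal) * z₁ x + (b : EReal) * z₂ x
      = ((a * (z₁ x).toReal + b * (z₂ x).toReal : ℝ) : EReal) := fun x hx => by
    rw [← h₁.1.coe_toReal hx, ← h₂.1.coe_toReal hx]
    simp
  refine ⟨⟨hw, fun x hx => ?_, ?_⟩, stronglyConvex_of_coe hw fun x y r s p q hx hy hp hq hpq => ?_⟩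
  · rw [he x hx]
    exact EReal.coe_ne_top _
  · refine ContinuousOn.congr ?_ he
    exact continuous_coe_real_ereal.comp_continuousOn
      ((continuousOn_const.mul h₁.1.continuousOn_toReal).add
        (continuousOn_const.mul h₂.1.continuousOn_toReal))
  · obtain ⟨x₁, x₂, e₁, e₂, rfl⟩ :=
      exists_coe_of_add_mul_eq_coe ha hb (h₁.1.ne_bot x) (h₂.1.ne_bot x) hx
    obtain ⟨y₁, y₂, e₃, e₄, rfl⟩ :=
      exists_coe_of_add_mul_eq_coe ha hb (h₁.1.ne_bot y) (h₂.1.ne_bot y) hy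
    obtain ⟨t, ht, ht'⟩ := h₁.2.exists_coe h₁.1.ne_bot e₁ e₃ hp.le hq.le hpq
    obtain ⟨u, hu, hu'⟩ := h₂.2.exists_coe h₂.1.ne_bot e₂ e₄ hp.le hq.le hpq
    rw [ht, hu, ← EReal.coe_mul, ← EReal.coe_mul, ← EReal.coe_add, EReal.coe_le_coe_iff]
    have h1 := mul_le_mul_of_nonneg_left ht' ha.le
    have h2 := mul_le_mul_of_nonneg_left hu' hb.le
    linarith

end UOT

/-- A convex function is locally Lipschitz in the interior of its domain, so Rademacher's theorem
applies near each point, and a locally null set is null. -/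
theorem ConvexOn.ae_differentiableAt {E : Type*} [NormedAddCommGroup E] [NormedSpace ℝ E]
    [FiniteDimensional ℝ E] [MeasurableSpace E] [BorelSpace E] (μ : Measure E)
    [μ.IsAddHaarMeasure] {s : Set E} {f : E → ℝ} (hf : ConvexOn ℝ s f) :
    ∀ᵐ x ∂μ, x ∈ interior s → DifferentiableAt ℝ f x := by
  have : SecondCountableTopology E := secondCountable_of_proper
  rw [ae_iff]
  refine measure_null_of_locally_null _ fun x hx => ?_
  simp only [mem_ofPred_eq, Classical.not_imp] at hx
  obtain ⟨K, t, ht, hK⟩ := hf.locallyLipschitzOn_interior hx.1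
  rw [isOpen_interior.nhdsWithin_eq hx.1] at ht
  refine ⟨{a | ¬(a ∈ interior s → DifferentiableAt ℝ f a)} ∩ interior t,
    inter_mem self_mem_nhdsWithin (mem_nhdsWithin_of_mem_nhds (interior_mem_nhds.2 ht)), ?_⟩
  refine measure_mono_null ?_ (ae_iff.1 ((hK.mono interior_subset).ae_differentiableWithinAt_of_mem
    (μ := μ)))
  rintro a ⟨ha, hat⟩
  simp only [mem_ofPred_eq, Classical.not_imp] at ha ⊢
  exact ⟨hat, fun h => ha.2 (h.differentiableAt (isOpen_interior.mem_nhds hat))⟩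

/-! ### Real-valued form of the semi-dual; conjugates of interpolated potentials. -/

namespace UOT

variable {d : ℕ} {X Y : Set (EuclideanSpace ℝ (Fin d))}
  {z z₀ z₁ z₂ : EuclideanSpace ℝ (Fin d) → EReal} {m : ℝ}
  {φ : ℝ≥0 → ℝ≥0∞} {μ ν : Measure (EuclideanSpace ℝ (Fin d))}

lemma convexOn_fenchel_toReal (hz : ∀ x, z x ≠ ⊥) (hb : ∀ y, fenchel z y ≠ ⊥) :
    ConvexOn ℝ {y | fenchel z y ≠ ⊤} (fun y => (fenchel z y).toReal) := by
  have key : ∀ y y' : EuclideanSpace ℝ (Fin d), fenchel z y ≠ ⊤ → fenchel z y' ≠ ⊤ →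
      ∀ a b : ℝ, 0 < a → 0 < b → a + b = 1 → fenchel z (a • y + b • y') ≠ ⊤ ∧
      (fenchel z (a • y + b • y')).toReal ≤ a * (fenchel z y).toReal + b * (fenchel z y').toReal := by
    intro y y' hy hy' a b ha hb' hab
    have h := fenchel_convex hz ha hb' hab (EReal.coe_toReal hy (hb y)).symm
      (EReal.coe_toReal hy' (hb y')).symm
    exact ⟨ne_top_of_le_ne_top (EReal.coe_ne_top _) h, EReal.toReal_le_toReal h (hb _)
      (EReal.coe_ne_top _)⟩
  refine convexOn_iff_forall_pos.2 ⟨convex_iff_forall_pos.2 fun y hy y' hy' a b ha hb' hab =>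
    (key y y' hy hy' a b ha hb' hab).1, fun y hy y' hy' a b ha hb' hab =>
    (key y y' hy hy' a b ha hb' hab).2⟩

lemma continuous_fenchel_toReal (hz : ∀ x, z x ≠ ⊥) (hb : ∀ y, fenchel z y ≠ ⊥)
    (ht : ∀ y, fenchel z y ≠ ⊤) : Continuous (fun y => (fenchel z y).toReal) := by
  have h := convexOn_fenchel_toReal hz hb
  have e : {y | fenchel z y ≠ ⊤} = univ := eq_univ_of_forall ht
  rw [e] at h
  exact h.locallyLipschitz.continuous

/-- The domain of a conjugate is convex, so its frontier is Lebesgue null. By absolute continuity,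
almost every point of finiteness is interior. -/
lemma ae_differentiableAt_fenchel (hz : ∀ x, z x ≠ ⊥) (hb : ∀ y, fenchel z y ≠ ⊥)
    (hν : ν ≪ volume) (hfin : ∀ᵐ y ∂ν, fenchel z y ≠ ⊤) :
    ∀ᵐ y ∂ν, (∀ᶠ u in 𝓝 y, fenchel z u ≠ ⊤) ∧
      DifferentiableAt ℝ (fun u => (fenchel z u).toReal) y := by
  have h := convexOn_fenchel_toReal hz hb
  have h1 : ∀ᵐ y ∂ν, y ∉ frontier {y | fenchel z y ≠ ⊤} :=
    hν (measure_eq_zero_iff_ae_notMem.1 (h.1.addHaar_frontier volume))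
  filter_upwards [h1, hν.ae_le (h.ae_differentiableAt volume), hfin] with y hy hd hf
  have hi : y ∈ interior {y | fenchel z y ≠ ⊤} := by
    by_contra hi
    exact hy ⟨subset_closure hf, hi⟩
  exact ⟨mem_interior_iff_mem_nhds.1 hi, hd hi⟩

lemma eintegral_entropyConj (hφ : φ 1 = 0) {ρ : Measure (EuclideanSpace ℝ (Fin d))}
    [IsFiniteMeasure ρ] (hz : ∀ᵐ x ∂ρ, z x ≠ ⊥) (hm : AEMeasurable z ρ) {C : ℝ}
    (hC : ∀ᵐ x ∂ρ, (C : EReal) ≤ entropyConj φ (z x - (quad x : EReal)))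
    (ht : eintegral ρ (fun x => entropyConj φ (z x - (quad x : EReal))) ≠ ⊤) :
    (∀ᵐ x ∂ρ, z x ≠ ⊤) ∧ Integrable (fun x => entropyConjReal φ ((z x).toReal - quad x)) ρ ∧
      eintegral ρ (fun x => entropyConj φ (z x - (quad x : EReal)))
        = ((∫ x, entropyConjReal φ ((z x).toReal - quad x) ∂ρ : ℝ) : EReal) := by
  obtain ⟨hi, he⟩ := ae_eq_coe_of_eintegral_ne_top hC (aemeasurable_entropyConj_sub hm) ht
  have h1 : ∀ᵐ x ∂ρ, z x ≠ ⊤ := by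
    filter_upwards [he] with x hx h0
    rw [h0, EReal.top_sub_coe, entropyConj_top hφ] at hx
    exact EReal.coe_ne_top _ hx.symm
  have h2 : ∀ᵐ x ∂ρ, (entropyConj φ (z x - (quad x : EReal))).toReal
      = entropyConjReal φ ((z x).toReal - quad x) := by
    filter_upwards [h1, hz] with x hx hx'
    rw [entropyConjReal, EReal.coe_sub, EReal.coe_toReal hx hx']
  have hi' := hi.congr h2
  refine ⟨h1, hi', ?_⟩
  rw [← eintegral_coe hi']
  refine eintegral_congr_ae ?_
  filter_upwards [he, h2] with x hx hx'
  rw [hx, hx']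

lemma semiDual_eq_integral (hφ : φ 1 = 0) (hX : IsCompact X) (hXne : X.Nonempty)
    (hY : IsCompact Y) [IsFiniteMeasure μ] [IsFiniteMeasure ν] (hμ : μ Xᶜ = 0) (hν : ν Yᶜ = 0)
    (hz : IsAdmissible X z) (ht : semiDual φ μ ν z ≠ ⊤) :
    (∀ᵐ y ∂ν, fenchel z y ≠ ⊤) ∧
      Integrable (fun x => entropyConjReal φ ((z x).toReal - quad x)) μ ∧
      Integrable (fun y => entropyConjReal φ ((fenchel z y).toReal - quad y)) ν ∧
      semiDual φ μ ν z = ((∫ x, entropyConjReal φ ((z x).toReal - quad x) ∂μ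
        + ∫ y, entropyConjReal φ ((fenchel z y).toReal - quad y) ∂ν : ℝ) : EReal) := by
  obtain ⟨C, hC₁, hC₂⟩ := hz.exists_entropyConj_bounds hφ hX hXne hY hμ hν
  have b₁ := eintegral_ne_bot hC₁
  have b₂ := eintegral_ne_bot hC₂
  obtain ⟨t₁, t₂⟩ := (EReal.add_ne_top_iff_ne_top₂ b₁ b₂).1 ht
  obtain ⟨-, i₁, e₁⟩ := eintegral_entropyConj hφ (Eventually.of_forall hz.ne_bot)
    (hz.aemeasurable hX hμ) hC₁ t₁
  obtain ⟨h, i₂, e₂⟩ := eintegral_entropyConj hφ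
    (Eventually.of_forall fun y => hz.fenchel_ne_bot hXne y)
    (measurable_fenchel hz.ne_bot).aemeasurable hC₂ t₂
  refine ⟨h, i₁, i₂, ?_⟩
  rw [semiDual, e₁, e₂, EReal.coe_add]

/-- Both arguments of `φ*` are bounded on the compact carriers, and `φ*` is finite and monotone. -/
lemma semiDual_ne_top (hφ : φ 1 = 0) (hfin : ∀ s : ℝ, entropyConj φ (s : EReal) ≠ ⊤)
    (hX : IsCompact X) (hXne : X.Nonempty)
    (hY : IsCompact Y) [IsFiniteMeasure μ] [IsFiniteMeasure ν] (hμ : μ Xᶜ = 0) (hν : ν Yᶜ = 0)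
    (hz : IsAdmissible X z) (ht : ∀ y, fenchel z y ≠ ⊤) : semiDual φ μ ν z ≠ ⊤ := by
  have hb := hz.fenchel_ne_bot hXne
  obtain ⟨C₁, h₁⟩ := hz.exists_bound hX
  obtain ⟨C₂, h₂⟩ := hY.exists_bound_of_continuousOn
    ((continuous_fenchel_toReal hz.ne_bot hb ht).sub continuous_quad).continuousOn
  have key : ∀ {ρ : Measure (EuclideanSpace ℝ (Fin d))} [IsFiniteMeasure ρ]
      {Z : Set (EuclideanSpace ℝ (Fin d))} {f : EuclideanSpace ℝ (Fin d) → EReal} {C : ℝ},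
      ρ Zᶜ = 0 → (∀ x ∈ Z, f x ≠ ⊤ ∧ f x ≠ ⊥ ∧ |(f x).toReal - quad x| ≤ C) →
      eintegral ρ (fun x => entropyConj φ (f x - (quad x : EReal))) ≠ ⊤ := by
    intro ρ _ Z f C hρ hf
    have h : (fun x => entropyConj φ (f x - (quad x : EReal))) ≤ᵐ[ρ]
        fun _ => ((entropyConjReal φ C : ℝ) : EReal) := by
      filter_upwards [mem_ae_iff.2 hρ] with x hx
      obtain ⟨h1, h2, h3⟩ := hf x hx
      rw [coe_entropyConjReal hφ hfin, ← EReal.coe_toReal h1 h2, ← EReal.coe_sub]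
      exact entropyConj_mono φ (EReal.coe_le_coe_iff.2 (abs_le.1 h3).2)
    have h' := eintegral_mono_ae h
    rw [eintegral_coe (integrable_const _)] at h'
    exact ne_top_of_le_ne_top (EReal.coe_ne_top _) h'
  exact EReal.add_ne_top
    (key hμ fun x hx => ⟨hz.ne_top x hx, hz.ne_bot x, h₁ x hx⟩)
    (key hν fun y hy => ⟨ht y, hb y, h₂ y hy⟩)

/-- Near-maximizers of a conjugate at a differentiability point concentrate at the gradient. -/
lemma fenchel_concentration (hb : ∀ y, fenchel z y ≠ ⊥) {y T : EuclideanSpace ℝ (Fin d)}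
    (hfin : ∀ᶠ u in 𝓝 y, fenchel z u ≠ ⊤)
    (hT : HasGradientAt (fun u => (fenchel z u).toReal) T y) {ε : ℝ} (hε : 0 < ε) :
    ∃ δ > 0, ∀ x, ∀ r : ℝ, z x = r →
      ⟪x, y⟫ - r ≤ (fenchel z y).toReal - δ * ‖x - T‖ + ε * δ := by
  rw [hasGradientAt_iff_isLittleO] at hT
  obtain ⟨δ, hδ, hball⟩ := Metric.eventually_nhds_iff.1 ((hT.def hε).and hfin)
  refine ⟨δ / 2, half_pos hδ, fun x r hr => ?_⟩
  have hy : fenchel z y ≠ ⊤ := hfin.self_of_nhds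
  rcases eq_or_ne x T with rfl | hne
  · have := inner_sub_le_of_fenchel_eq hr (EReal.coe_toReal hy (hb y)).symm
    rw [sub_self, norm_zero, mul_zero, sub_zero]
    nlinarith
  have hpos : 0 < ‖x - T‖ := norm_pos_iff.2 (sub_ne_zero.2 hne)
  -- Testing the conjugate at `y + h`, with `h` pointing from `T` to `x`, yields `⟪x - T, h⟫ = δ / 2
  -- * ‖x - T‖` against an expansion error of at most `ε * (δ / 2)`.
  set h := (δ / 2 / ‖x - T‖) • (x - T) with hh
  have hnorm : ‖h‖ = δ / 2 := by
    rw [hh, norm_smul, Real.norm_of_nonneg (by positivity), div_mul_cancel₀ _ hpos.ne']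
  obtain ⟨h1, h2⟩ := hball (y := y + h) (by
    rw [dist_eq_norm, add_sub_cancel_left, hnorm]
    linarith)
  rw [add_sub_cancel_left, hnorm, Real.norm_eq_abs] at h1
  have h3 := (abs_le.1 h1).2
  have h4 := inner_sub_le_of_fenchel_eq hr (EReal.coe_toReal h2 (hb _)).symm
  rw [inner_add_right] at h4
  have h5 : ⟪x, h⟫ - ⟪T, h⟫ = δ / 2 * ‖x - T‖ := by
    rw [← inner_sub_left, hh, real_inner_smul_right, real_inner_self_eq_norm_sq]
    field_simp
  linarith

/-- Near `T` the `z` term loses at least `m/2 * D`, since `D < ‖x - S‖²` is an open condition. Away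
from `T` the `z₀` term loses a fixed amount, which exceeds `t * (m/2 * D)` for small `t`. -/
lemma fenchel_interpolation_le (hz₀ : ∀ x, z₀ x ≠ ⊥) (hz : ∀ x, z x ≠ ⊥)
    (hb : ∀ y, fenchel z₀ y ≠ ⊥) {y T S : EuclideanSpace ℝ (Fin d)}
    (hfin : ∀ᶠ u in 𝓝 y, fenchel z₀ u ≠ ⊤)
    (hT : HasGradientAt (fun u => (fenchel z₀ u).toReal) T y) (hm : 0 < m) {f : ℝ}
    (hS : ∀ x, ∀ r : ℝ, z x = r → ⟪x, y⟫ - r ≤ f - m / 2 * ‖x - S‖ ^ 2)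
    {D : ℝ} (hD : D < ‖T - S‖ ^ 2) :
    ∀ᶠ t : ℝ in 𝓝[>] 0, fenchel (fun x => ((1 - t : ℝ) : EReal) * z₀ x + (t : EReal) * z x) y
      ≤ (((1 - t) * (fenchel z₀ y).toReal + t * (f - m / 2 * D) : ℝ) : EReal) := by
  have hopen : {x : EuclideanSpace ℝ (Fin d) | D < ‖x - S‖ ^ 2} ∈ 𝓝 T :=
    (isOpen_lt continuous_const (by fun_prop)).mem_nhds hD
  obtain ⟨ε, hε, hball⟩ := Metric.mem_nhds_iff.1 hopen
  obtain ⟨δ, hδ, hconc⟩ := fenchel_concentration hb hfin hT (half_pos hε)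
  have hev : ∀ᶠ t : ℝ in 𝓝[>] 0, t * (m / 2 * D) - (1 - t) * (δ * ε / 2) < 0 := by
    have hc : ContinuousAt (fun t : ℝ => t * (m / 2 * D) - (1 - t) * (δ * ε / 2)) 0 := by fun_prop
    refine (hc.eventually (gt_mem_nhds ?_)).filter_mono nhdsWithin_le_nhds
    have := mul_pos hδ hε
    linarith
  have hy : fenchel z₀ y ≠ ⊤ := hfin.self_of_nhds
  filter_upwards [hev, Ioo_mem_nhdsGT (zero_lt_one' ℝ)] with t ht ht'
  have ht1 : 0 < 1 - t := sub_pos.2 ht'.2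
  rw [fenchel_le_coe_iff fun x => EReal.add_ne_bot_iff.2 ⟨coe_mul_ne_bot ht1 (hz₀ x),
    coe_mul_ne_bot ht'.1 (hz x)⟩]
  intro x r hr
  obtain ⟨r₀, r₁, h₀, h₁, rfl⟩ := exists_coe_of_add_mul_eq_coe ht1 ht'.1 (hz₀ x) (hz x) hr
  have k1 := hS x r₁ h₁
  have e : ⟪x, y⟫ - ((1 - t) * r₀ + t * r₁) = (1 - t) * (⟪x, y⟫ - r₀) + t * (⟪x, y⟫ - r₁) := by ring
  rw [e]
  rcases lt_or_ge ‖x - T‖ ε with h | h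
  · have k2 := inner_sub_le_of_fenchel_eq h₀ (EReal.coe_toReal hy (hb y)).symm
    have k3 : D < ‖x - S‖ ^ 2 := hball (by rwa [Metric.mem_ball, dist_eq_norm])
    have k4 : m / 2 * D ≤ m / 2 * ‖x - S‖ ^ 2 := by gcongr
    exact add_le_add (mul_le_mul_of_nonneg_left k2 ht1.le)
      (mul_le_mul_of_nonneg_left (by linarith) ht'.1.le)
  · have k2 := hconc x r₀ h₀
    have k3 : δ * ε ≤ δ * ‖x - T‖ := by gcongr
    have k4 : 0 ≤ m / 2 * ‖x - S‖ ^ 2 := by positivity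
    have k5 : ⟪x, y⟫ - r₀ ≤ (fenchel z₀ y).toReal - δ * ε / 2 := by linarith
    have k6 : ⟪x, y⟫ - r₁ ≤ f := by linarith
    have k7 := mul_le_mul_of_nonneg_left k5 ht1.le
    have k8 := mul_le_mul_of_nonneg_left k6 ht'.1.le
    linarith

/-- Lower limit of the gap between an increment and a difference quotient. -/
lemma ofReal_le_liminf_gap {g : ℝ → ℝ} {a c k : ℝ} (hg : DifferentiableAt ℝ g a) {t : ℕ → ℝ}
    (ht : Tendsto t atTop (𝓝[>] 0)) {γ : ℕ → ℝ} (hγ : ∀ᶠ n in atTop, γ n ≤ g (a + t n * c)) :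
    ENNReal.ofReal (k - deriv g a * c)
      ≤ liminf (fun n => ENNReal.ofReal (k - (γ n - g a) / t n)) atTop := by
  have hd : HasDerivAt (fun s : ℝ => g (a + s * c)) (deriv g a * c) 0 := by
    have h1 : HasDerivAt (fun s : ℝ => a + s * c) c 0 := by
      simpa using ((hasDerivAt_id (0 : ℝ)).mul_const c).const_add a
    have h2 : HasDerivAt g (deriv g a) (a + 0 * c) := by simpa using hg.hasDerivAt
    exact h2.comp (0 : ℝ) h1
  have h0 := hasDerivAt_iff_tendsto_slope_zero.1 hd
  have h1 := (h0.mono_left (nhdsWithin_mono 0 fun s (hs : s ∈ Ioi 0) => (ne_of_gt hs))).comp ht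
  have h2 := ENNReal.tendsto_ofReal (h1.const_sub k)
  rw [← h2.liminf_eq]
  refine liminf_le_liminf ?_
  filter_upwards [hγ, ht.eventually self_mem_nhdsWithin] with n hn hn'
  have hn' : 0 < t n := hn'
  refine ENNReal.ofReal_le_ofReal (sub_le_sub_left ?_ k)
  simp only [Function.comp, zero_add, zero_mul, add_zero, smul_eq_mul]
  rw [div_eq_inv_mul]
  gcongr

end UOT

/-! ### The Bregman estimate, by optimality and Fatou's lemma. -/

namespace UOT

variable {d : ℕ} {X Y : Set (EuclideanSpace ℝ (Fin d))}
  {z z₀ z₁ z₂ : EuclideanSpace ℝ (Fin d) → EReal} {m : ℝ}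
  {φ : ℝ≥0 → ℝ≥0∞} {μ ν : Measure (EuclideanSpace ℝ (Fin d))}

/-- Monotonicity of `g` transfers the bound on the interpolated conjugate to the difference quotient
for each `D < ‖T - S‖²`; then `D` increases to `‖T - S‖²`. -/
lemma ofReal_le_liminf_fenchel_gap {g : ℝ → ℝ} (hg : Differentiable ℝ g) (hmono : Monotone g)
    (hz₀ : ∀ x, z₀ x ≠ ⊥) (hz : ∀ x, z x ≠ ⊥)
    (hb : ∀ y, fenchel z₀ y ≠ ⊥) {y T S : EuclideanSpace ℝ (Fin d)}
    (hfin : ∀ᶠ u in 𝓝 y, fenchel z₀ u ≠ ⊤)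
    (hT : HasGradientAt (fun u => (fenchel z₀ u).toReal) T y) (hm : 0 < m) {f : ℝ}
    (hS : ∀ x, ∀ r : ℝ, z x = r → ⟪x, y⟫ - r ≤ f - m / 2 * ‖x - S‖ ^ 2)
    {t : ℕ → ℝ} (ht : Tendsto t atTop (𝓝[>] 0))
    (hw : ∀ n, fenchel (fun x => ((1 - t n : ℝ) : EReal) * z₀ x + (t n : EReal) * z x) y ≠ ⊥)
    (q k : ℝ) :
    ENNReal.ofReal (k - deriv g ((fenchel z₀ y).toReal - q) * (f - (fenchel z₀ y).toReal)
        + deriv g ((fenchel z₀ y).toReal - q) * (m / 2 * ‖T - S‖ ^ 2))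
      ≤ liminf (fun n => ENNReal.ofReal (k -
        (g ((fenchel (fun x => ((1 - t n : ℝ) : EReal) * z₀ x + (t n : EReal) * z x) y).toReal - q)
          - g ((fenchel z₀ y).toReal - q)) / t n)) atTop := by
  set f₀ := (fenchel z₀ y).toReal
  have key : ∀ D, D < ‖T - S‖ ^ 2 →
      ENNReal.ofReal (k - deriv g (f₀ - q) * (f - f₀ - m / 2 * D)) ≤ liminf (fun n =>
        ENNReal.ofReal (k -
        (g ((fenchel (fun x => ((1 - t n : ℝ) : EReal) * z₀ x + (t n : EReal) * z x) y).toReal - q)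
          - g (f₀ - q)) / t n)) atTop := by
    intro D hD
    refine ofReal_le_liminf_gap (hg _) ht ?_
    filter_upwards [ht.eventually (fenchel_interpolation_le hz₀ hz hb hfin hT hm hS hD)] with n hn
    refine hmono ?_
    have := EReal.toReal_le_toReal hn (hw n) (EReal.coe_ne_top _)
    rw [EReal.toReal_coe] at this
    linarith
  have hlim : Tendsto (fun D => ENNReal.ofReal (k - deriv g (f₀ - q) * (f - f₀ - m / 2 * D)))
      (𝓝[<] (‖T - S‖ ^ 2))
      (𝓝 (ENNReal.ofReal (k - deriv g (f₀ - q) * (f - f₀ - m / 2 * ‖T - S‖ ^ 2)))) := by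
    refine ENNReal.tendsto_ofReal (Tendsto.mono_left (Continuous.tendsto ?_ _) nhdsWithin_le_nhds)
    fun_prop
  have h := le_of_tendsto hlim (by
    filter_upwards [self_mem_nhdsWithin] with D hD using key D hD)
  refine le_trans (le_of_eq ?_) h
  congr 1
  ring

lemma liminf_add_liminf_le {u v : ℕ → ℝ≥0∞} {c : ℝ≥0∞} (h : ∀ n, u n + v n ≤ c) :
    liminf u atTop + liminf v atTop ≤ c := by
  rw [liminf_eq_iSup_iInf_of_nat, liminf_eq_iSup_iInf_of_nat,
    ENNReal.iSup_add_iSup_of_monotone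
      (fun _ _ hab => biInf_mono fun _ hi => hab.trans hi)
      (fun _ _ hab => biInf_mono fun _ hi => hab.trans hi)]
  exact iSup_le fun n => (add_le_add (iInf₂_le n le_rfl) (iInf₂_le n le_rfl)).trans (h n)

lemma convex_gap_nonneg {g : ℝ → ℝ} (hg : ConvexOn ℝ univ g) {a b γ t : ℝ} (ht : 0 < t)
    (ht1 : t < 1) (hγ : γ ≤ g ((1 - t) * a + t * b)) : 0 ≤ g b - g a - (γ - g a) / t := by
  have h := hg.2 (mem_univ a) (mem_univ b) (sub_nonneg.2 ht1.le) ht.le (by ring)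
  simp only [smul_eq_mul] at h
  rw [sub_nonneg, div_le_iff₀ ht]
  linarith

/-- The estimate before the convexity constants are introduced: both integrands are Bregman
divergences of `φ*`, the second one augmented by the gradient term. -/
lemma lintegral_bregman_le (hφ : φ 1 = 0) (hfin : ∀ s : ℝ, entropyConj φ (s : EReal) ≠ ⊤)
    (hd : Differentiable ℝ (entropyConjReal φ)) (hX : IsCompact X) (hXne : X.Nonempty)
    (hY : IsCompact Y) [IsFiniteMeasure μ] [IsFiniteMeasure ν] (hμ : μ Xᶜ = 0) (hν : ν Yᶜ = 0)
    (hac : ν ≪ volume) (hopt : IsOptimal φ X μ ν z₀) (hm : 0 < m) (hz : IsPotential X z)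
    (hc : StronglyConvex m z) :
    ∃ J J₀ : ℝ, semiDual φ μ ν z = J ∧ semiDual φ μ ν z₀ = J₀ ∧
      ∫⁻ x, ENNReal.ofReal (entropyConjReal φ ((z x).toReal - quad x)
          - entropyConjReal φ ((z₀ x).toReal - quad x)
          - deriv (entropyConjReal φ) ((z₀ x).toReal - quad x)
            * ((z x).toReal - (z₀ x).toReal)) ∂μ
      + ∫⁻ y, ENNReal.ofReal (entropyConjReal φ ((fenchel z y).toReal - quad y)
          - entropyConjReal φ ((fenchel z₀ y).toReal - quad y)
          - deriv (entropyConjReal φ) ((fenchel z₀ y).toReal - quad y)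
            * ((fenchel z y).toReal - (fenchel z₀ y).toReal)
          + deriv (entropyConjReal φ) ((fenchel z₀ y).toReal - quad y)
            * (m / 2 * ‖gradient (fun u => (fenchel z₀ u).toReal - (fenchel z u).toReal) y‖ ^ 2)) ∂ν
      ≤ ENNReal.ofReal (J - J₀) := by
  have hmono := entropyConjReal_mono hφ hfin
  have hconv := entropyConjReal_convex hφ hfin
  obtain ⟨x₁, hx₁⟩ := hXne
  have hXne : X.Nonempty := ⟨x₁, hx₁⟩
  have hzt : ∀ y, fenchel z y ≠ ⊤ := fun y =>
    StronglyConvex.fenchel_ne_top hz.1.ne_bot hm hz.2 hc (hz.1.ne_top x₁ hx₁) y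
  have hzb := hz.1.fenchel_ne_bot hXne
  have hz₀ := hopt.1
  have hz₀b := hz₀.1.fenchel_ne_bot hXne
  have hJt := semiDual_ne_top (μ := μ) (ν := ν) hφ hfin hX hXne hY hμ hν hz.1 hzt
  have hJ₀t : semiDual φ μ ν z₀ ≠ ⊤ := ne_top_of_le_ne_top hJt (hopt.2 z hz)
  obtain ⟨-, iμ, iν, eJ⟩ := semiDual_eq_integral hφ hX hXne hY hμ hν hz.1 hJt
  obtain ⟨hf₀, iμ₀, iν₀, eJ₀⟩ := semiDual_eq_integral hφ hX hXne hY hμ hν hz₀.1 hJ₀t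
  set g := entropyConjReal φ
  refine ⟨_, _, eJ, eJ₀, ?_⟩
  -- The shift by `2` keeps `t n < 1` for every `n`, so both interpolation weights are positive.
  set t : ℕ → ℝ := fun n => 1 / ((n : ℝ) + 2) with ht_def
  have ht0 : ∀ n, 0 < t n := fun n => by positivity
  have ht1 : ∀ n, t n < 1 := fun n => by
    rw [ht_def]
    simp only
    rw [div_lt_one (by positivity)]
    have : (0 : ℝ) ≤ n := n.cast_nonneg
    linarith
  have ht : Tendsto t atTop (𝓝[>] 0) := by
    refine tendsto_nhdsWithin_iff.2 ⟨?_, Eventually.of_forall ht0⟩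
    have h := (tendsto_one_div_add_atTop_nhds_zero_nat (𝕜 := ℝ)).comp (tendsto_add_atTop_nat 1)
    refine h.congr fun n => ?_
    simp only [ht_def, Function.comp]
    push_cast
    ring_nf
  set w : ℕ → EuclideanSpace ℝ (Fin d) → EReal :=
    fun n x => ((1 - t n : ℝ) : EReal) * z₀ x + (t n : EReal) * z x with hw_def
  have hw : ∀ n, IsPotential X (w n) := fun n =>
    isPotential_add_mul hz₀ hz (sub_pos.2 (ht1 n)) (ht0 n)
  have hwb : ∀ n y, fenchel (w n) y ≠ ⊥ := fun n => (hw n).1.fenchel_ne_bot hXne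
  have hwJ : ∀ n, semiDual φ μ ν (w n) ≠ ⊤ := fun n => by
    refine ne_top_of_le_ne_top ?_ (semiDual_convex hφ hX hXne hY hμ hν hz₀.1 hz.1
      (sub_nonneg.2 (ht1 n).le) (ht0 n).le (by ring))
    rw [eJ, eJ₀]
    norm_cast
    exact EReal.coe_ne_top _
  have hwI := fun n => semiDual_eq_integral hφ hX hXne hY hμ hν (hw n).1 (hwJ n)
  -- the nonnegative gaps
  set A : ℕ → EuclideanSpace ℝ (Fin d) → ℝ := fun n x =>
    g ((z x).toReal - quad x) - g ((z₀ x).toReal - quad x)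
      - (g ((w n x).toReal - quad x) - g ((z₀ x).toReal - quad x)) / t n with hA
  set B : ℕ → EuclideanSpace ℝ (Fin d) → ℝ := fun n y =>
    g ((fenchel z y).toReal - quad y) - g ((fenchel z₀ y).toReal - quad y)
      - (g ((fenchel (w n) y).toReal - quad y) - g ((fenchel z₀ y).toReal - quad y)) / t n with hB
  have hwX : ∀ n, ∀ x ∈ X, (w n x).toReal - quad x
      = (1 - t n) * ((z₀ x).toReal - quad x) + t n * ((z x).toReal - quad x) := fun n x hx => by
    have : w n x = (((1 - t n) * (z₀ x).toReal + t n * (z x).toReal : ℝ) : EReal) := by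
      rw [EReal.coe_add, EReal.coe_mul, EReal.coe_mul, hz₀.1.coe_toReal hx, hz.1.coe_toReal hx]
    rw [this, EReal.toReal_coe]
    ring
  have hAi : ∀ n, Integrable (A n) μ := fun n =>
    (iμ.sub iμ₀).sub (((hwI n).2.1.sub iμ₀).div_const _)
  have hBi : ∀ n, Integrable (B n) ν := fun n =>
    (iν.sub iν₀).sub (((hwI n).2.2.1.sub iν₀).div_const _)
  have hA0 : ∀ n, 0 ≤ᵐ[μ] A n := fun n => by
    filter_upwards [mem_ae_iff.2 hμ] with x hx
    exact convex_gap_nonneg hconv (ht0 n) (ht1 n) (by rw [hwX n x hx])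
  have hB0 : ∀ n, 0 ≤ᵐ[ν] B n := fun n => by
    filter_upwards [hf₀] with y hy
    refine convex_gap_nonneg hconv (ht0 n) (ht1 n) (hmono ?_)
    have h := fenchel_add_mul_le hz₀.1.ne_bot hz.1.ne_bot (sub_pos.2 (ht1 n)) (ht0 n) (by ring)
      (hz₀b y) (hzb y)
    rw [← EReal.coe_toReal hy (hz₀b y), ← EReal.coe_toReal (hzt y) (hzb y), ← EReal.coe_mul,
      ← EReal.coe_mul, ← EReal.coe_add] at h
    have h' := EReal.toReal_le_toReal h (hwb n y) (EReal.coe_ne_top _)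
    rw [EReal.toReal_coe] at h'
    linarith
  -- The gaps integrate to `J(z) - J(z₀) - (J(w n) - J(z₀)) / t n`, and the subtracted quotient is
  -- nonnegative by optimality.
  have hsum : ∀ n, ∫⁻ x, ENNReal.ofReal (A n x) ∂μ + ∫⁻ y, ENNReal.ofReal (B n y) ∂ν
      ≤ ENNReal.ofReal (∫ x, g ((z x).toReal - quad x) ∂μ
        + ∫ y, g ((fenchel z y).toReal - quad y) ∂ν - (∫ x, g ((z₀ x).toReal - quad x) ∂μ
        + ∫ y, g ((fenchel z₀ y).toReal - quad y) ∂ν)) := fun n => by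
    rw [← ofReal_integral_eq_lintegral_ofReal (hAi n) (hA0 n),
      ← ofReal_integral_eq_lintegral_ofReal (hBi n) (hB0 n),
      ← ENNReal.ofReal_add (integral_nonneg_of_ae (hA0 n)) (integral_nonneg_of_ae (hB0 n))]
    refine ENNReal.ofReal_le_ofReal ?_
    have h := hopt.2 _ (hw n)
    rw [eJ₀, (hwI n).2.2.2, EReal.coe_le_coe_iff] at h
    have eA : ∫ x, A n x ∂μ = _ :=
      integral_sub (iμ.sub iμ₀) (((hwI n).2.1.sub iμ₀).div_const (t n))
    have eB : ∫ y, B n y ∂ν = _ :=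
      integral_sub (iν.sub iν₀) (((hwI n).2.2.1.sub iν₀).div_const (t n))
    rw [eA, eB, integral_div, integral_div, integral_sub iμ iμ₀, integral_sub iν iν₀,
      integral_sub (hwI n).2.1 iμ₀, integral_sub (hwI n).2.2.1 iν₀]
    have h' := div_nonneg (sub_nonneg.2 h) (ht0 n).le
    have e : ∀ p q r s : ℝ, (p + q - (r + s)) / t n = (p - r) / t n + (q - s) / t n := by
      intros
      ring
    rw [e] at h'
    linarith
  have hFA := lintegral_liminf_le' (μ := μ) (u := atTop) fun n => (hAi n).aemeasurable.ennreal_ofReal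
  have hFB := lintegral_liminf_le' (μ := ν) (u := atTop) fun n => (hBi n).aemeasurable.ennreal_ofReal
  refine le_trans (add_le_add (le_trans (lintegral_mono_ae ?_) hFA)
    (le_trans (lintegral_mono_ae ?_) hFB)) (liminf_add_liminf_le hsum)
  · filter_upwards [mem_ae_iff.2 hμ] with x hx
    -- On `X` the interpolation is exactly affine in `t`, so no loss or gain occurs here.
    refine ofReal_le_liminf_gap (hd _) ht (Eventually.of_forall fun n => le_of_eq ?_)
    rw [hwX n x hx]
    congr 1
    ring
  · filter_upwards [ae_differentiableAt_fenchel hz₀.1.ne_bot hz₀b hac hf₀] with y hy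
    obtain ⟨S, hS, hS'⟩ := hc.hasGradientAt_fenchel hz.1.ne_bot hm
      (f := fun y => (fenchel z y).toReal) (fun y => (EReal.coe_toReal (hzt y) (hzb y)).symm) y
    have hT := hy.2.hasGradientAt
    have hgrad : gradient (fun u => (fenchel z₀ u).toReal - (fenchel z u).toReal) y
        = gradient (fun u => (fenchel z₀ u).toReal) y - S :=
      (hasGradientAt_iff_hasFDerivAt.2 (by
        rw [map_sub]
        exact hT.hasFDerivAt.sub hS.hasFDerivAt)).gradient
    rw [hgrad]
    exact ofReal_le_liminf_fenchel_gap hd hmono hz₀.1.ne_bot hz.1.ne_bot hz₀b hy.1 hT hm hS' ht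
      (fun n => hwb n y) _ _

end UOT

/-- Strong convexity on the segment, divided by `t`, bounds the difference quotient at `a`; then `t
→ 0⁺`. -/
theorem StrongConvexOn.deriv_mul_add_le {s : Set ℝ} {m : ℝ} {g : ℝ → ℝ}
    (hg : StrongConvexOn s m g) {a b : ℝ} (ha : a ∈ s) (hb : b ∈ s)
    (hd : DifferentiableAt ℝ g a) :
    deriv g a * (b - a) + m / 2 * (b - a) ^ 2 ≤ g b - g a := by
  have hder : HasDerivAt (fun t : ℝ => g (a + t * (b - a))) (deriv g a * (b - a)) 0 := by
    have h1 : HasDerivAt (fun t : ℝ => a + t * (b - a)) (b - a) 0 := by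
      simpa using ((hasDerivAt_id (0 : ℝ)).mul_const (b - a)).const_add a
    have h2 : HasDerivAt g (deriv g a) (a + 0 * (b - a)) := by simpa using hd.hasDerivAt
    exact h2.comp (0 : ℝ) h1
  have h1 := (hasDerivAt_iff_tendsto_slope_zero.1 hder).mono_left
    (nhdsWithin_mono 0 fun s (hs : s ∈ Ioi 0) => ne_of_gt hs)
  have h2 : Tendsto (fun t : ℝ => (1 - t) * (m / 2 * (b - a) ^ 2)) (𝓝[>] 0)
      (𝓝 ((1 - 0) * (m / 2 * (b - a) ^ 2))) :=
    Tendsto.mono_left (Continuous.tendsto (by fun_prop) 0) nhdsWithin_le_nhds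
  rw [sub_zero, one_mul] at h2
  refine le_of_tendsto (h1.add h2) ?_
  filter_upwards [Ioo_mem_nhdsGT (zero_lt_one' ℝ)] with t ht
  have h := hg.2 ha hb (sub_nonneg.2 ht.2.le) ht.1.le (by ring)
  simp only [smul_eq_mul, Real.norm_eq_abs, sq_abs] at h
  have e : (1 - t) * a + t * b = a + t * (b - a) := by ring
  rw [e] at h
  have ht0 := ht.1
  simp only [zero_add, zero_mul, add_zero, smul_eq_mul]
  have h3 : g (a + t * (b - a)) - g a
      ≤ t * (g b - g a - (1 - t) * (m / 2 * (b - a) ^ 2)) := by nlinarith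
  rw [inv_mul_eq_div, ← le_sub_iff_add_le, div_le_iff₀ ht0]
  linarith

/-- If `g s = g t`, the midpoint value is at least `g s` by monotonicity but strictly below it by
strong convexity. -/
theorem Monotone.strictMono_of_strongConvexOn {g : ℝ → ℝ} (hg : Monotone g)
    (hs : ∀ s t : ℝ, ∃ m : ℝ, 0 < m ∧ StrongConvexOn (Icc s t) m g) : StrictMono g := by
  intro s t hst
  refine lt_of_le_of_ne (hg hst.le) fun he => ?_
  obtain ⟨m, hm, hc⟩ := hs s t
  have h := hc.2 (left_mem_Icc.2 hst.le) (right_mem_Icc.2 hst.le)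
    (show (0 : ℝ) ≤ 1 / 2 by norm_num) (show (0 : ℝ) ≤ 1 / 2 by norm_num) (by norm_num)
  simp only [smul_eq_mul, Real.norm_eq_abs, sq_abs] at h
  have h1 : g s ≤ g (1 / 2 * s + 1 / 2 * t) := hg (by linarith)
  have h2 : 0 < m * (s - t) ^ 2 := mul_pos hm (by nlinarith)
  nlinarith

/-! ### Convexity constants and their uniform positivity. -/

namespace UOT

variable {d : ℕ} {X Y : Set (EuclideanSpace ℝ (Fin d))}
  {z z₀ z₁ z₂ : EuclideanSpace ℝ (Fin d) → EReal} {m : ℝ}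
  {φ : ℝ≥0 → ℝ≥0∞} {μ ν : Measure (EuclideanSpace ℝ (Fin d))}

lemma stabConst_mul_le {ρ : Measure (EuclideanSpace ℝ (Fin d))}
    {f₀ f : EuclideanSpace ℝ (Fin d) → EReal} {x : EuclideanSpace ℝ (Fin d)}
    (hx : x ∈ ρ.support) :
    stabConst φ ρ f₀ f * ENNReal.ofReal (((f₀ x).toReal - (f x).toReal) ^ 2)
      ≤ ENNReal.ofReal (entropyConjReal φ ((f x).toReal - quad x)
          - entropyConjReal φ ((f₀ x).toReal - quad x)
          - deriv (entropyConjReal φ) ((f₀ x).toReal - quad x)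
            * ((f x).toReal - (f₀ x).toReal)) := by
  -- In the equality case the constant may be `⊤`; the left side vanishes by the convention `⊤ * 0 =
  -- 0`.
  rcases eq_or_ne (f₀ x).toReal (f x).toReal with h | h
  · simp [h]
  have hC : stabConst φ ρ f₀ f ≤
      convexityModulus φ ((f₀ x).toReal - quad x) ((f x).toReal - quad x) := iInf₂_le x hx
  have hne : (f₀ x).toReal - quad x ≠ (f x).toReal - quad x := fun h' => h (sub_left_inj.1 h')
  rw [convexityModulus, if_neg hne, sub_sub_sub_cancel_right] at hC
  have hpos : 0 < ((f x).toReal - (f₀ x).toReal) ^ 2 := by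
    have := sub_ne_zero.2 h.symm
    positivity
  refine (mul_le_mul_left hC _).trans (le_of_eq ?_)
  rw [← ENNReal.ofReal_mul' (sq_nonneg _), ← neg_sub (f x).toReal (f₀ x).toReal, neg_sq,
    div_mul_cancel₀ _ hpos.ne']

lemma stabConst_mul_sqDist_add_le_of_ae {ρ : Measure (EuclideanSpace ℝ (Fin d))}
    {f₀ f : EuclideanSpace ℝ (Fin d) → EReal} (h₀ : AEMeasurable f₀ ρ) (h : AEMeasurable f ρ)
    {k G : EuclideanSpace ℝ (Fin d) → ℝ≥0∞}
    (hk : ∀ x ∈ ρ.support, ENNReal.ofReal (entropyConjReal φ ((f x).toReal - quad x)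
          - entropyConjReal φ ((f₀ x).toReal - quad x)
          - deriv (entropyConjReal φ) ((f₀ x).toReal - quad x)
            * ((f x).toReal - (f₀ x).toReal)) + k x ≤ G x) :
    stabConst φ ρ f₀ f * sqDist ρ f₀ f + ∫⁻ x, k x ∂ρ ≤ ∫⁻ x, G x ∂ρ := by
  have hm : AEMeasurable (fun x => ENNReal.ofReal (((f₀ x).toReal - (f x).toReal) ^ 2)) ρ :=
    (((measurable_ereal_toReal.comp_aemeasurable h₀).sub
      (measurable_ereal_toReal.comp_aemeasurable h)).pow_const 2).ennreal_ofReal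
  rw [sqDist, ← lintegral_const_mul'' _ hm, ← lintegral_add_left' (hm.const_mul _)]
  refine lintegral_mono_ae ?_
  filter_upwards [Measure.support_mem_ae (μ := ρ)] with x hx
  exact (add_le_add_left (stabConst_mul_le hx) _).trans (hk x hx)

/-- The Bregman divergence and the gradient term are both nonnegative, so `ENNReal.ofReal` of their
sum splits. The first gives the squared distances, and the weight `(φ*)' ≥ 0` of the second is the
density of the tilted measure. -/
lemma stability_estimate_ennreal (hφ : φ 1 = 0) (hfin : ∀ s : ℝ, entropyConj φ (s : EReal) ≠ ⊤)
    (hd : Differentiable ℝ (entropyConjReal φ)) (hX : IsCompact X) (hXne : X.Nonempty)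
    (hY : IsCompact Y) [IsFiniteMeasure μ] [IsFiniteMeasure ν] (hμ : μ Xᶜ = 0) (hν : ν Yᶜ = 0)
    (hac : ν ≪ volume) (hopt : IsOptimal φ X μ ν z₀) (hm : 0 < m) (hz : IsPotential X z)
    (hc : StronglyConvex m z) :
    ∃ J J₀ : ℝ, semiDual φ μ ν z = J ∧ semiDual φ μ ν z₀ = J₀ ∧
      ENNReal.ofReal (m / 2) * gradSqDist (tiltedTarget φ ν z₀) (fenchel z₀) (fenchel z)
        + stabConst φ ν (fenchel z₀) (fenchel z) * sqDist ν (fenchel z₀) (fenchel z)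
        + stabConst φ μ z₀ z * sqDist μ z₀ z ≤ ENNReal.ofReal (J - J₀) := by
  obtain ⟨J, J₀, hJ, hJ₀, h⟩ :=
    lintegral_bregman_le hφ hfin hd hX hXne hY hμ hν hac hopt hm hz hc
  refine ⟨J, J₀, hJ, hJ₀, le_trans ?_ h⟩
  have hconv := entropyConjReal_convex hφ hfin
  have hder : ∀ a, 0 ≤ deriv (entropyConjReal φ) a := fun a =>
    (entropyConjReal_mono hφ hfin).deriv_nonneg
  have hM := stabConst_mul_sqDist_add_le_of_ae (φ := φ) (ρ := μ)
    (hopt.1.1.aemeasurable hX hμ) (hz.1.aemeasurable hX hμ) (k := 0) fun x _ => by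
      simp only [Pi.zero_apply, add_zero]
      exact le_rfl
  simp only [Pi.zero_apply, lintegral_zero, add_zero] at hM
  rw [add_comm _ (stabConst φ μ z₀ z * _), add_comm (ENNReal.ofReal (m / 2) * _)]
  refine add_le_add hM (le_trans (add_le_add_right ?_ _) (stabConst_mul_sqDist_add_le_of_ae
    (φ := φ) (ρ := ν) (measurable_fenchel hopt.1.1.ne_bot).aemeasurable
    (measurable_fenchel hz.1.ne_bot).aemeasurable
    (k := fun y => ENNReal.ofReal (m / 2) * (ENNReal.ofReal (deriv (entropyConjReal φ)
      ((fenchel z₀ y).toReal - quad y)) * ENNReal.ofReal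
        (‖gradient (fun u => (fenchel z₀ u).toReal - (fenchel z u).toReal) y‖ ^ 2)))
    fun y _ => ?_))
  · rw [gradSqDist, tiltedTarget, lintegral_const_mul' _ _ ENNReal.ofReal_ne_top]
    -- This direction needs measurability of the density only, not of the gradient.
    refine mul_le_mul_right (lintegral_withDensity_le_lintegral_mul ν ?_ _) _
    exact ((measurable_deriv _).comp ((measurable_fenchel hopt.1.1.ne_bot).ereal_toReal.sub
      continuous_quad.measurable)).ennreal_ofReal
  · have hb := (strongConvexOn_zero.2 hconv).deriv_mul_add_le
      (mem_univ ((fenchel z₀ y).toReal - quad y)) (mem_univ ((fenchel z y).toReal - quad y)) (hd _)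
    rw [sub_sub_sub_cancel_right, zero_div, zero_mul, add_zero] at hb
    rw [← ENNReal.ofReal_mul (hder _), ← ENNReal.ofReal_mul (by positivity),
      ← ENNReal.ofReal_add (by linarith)
        (mul_nonneg (by positivity) (mul_nonneg (hder _) (sq_nonneg _)))]
    refine ENNReal.ofReal_le_ofReal (le_of_eq ?_)
    ring

lemma stability_estimate (hφ : φ 1 = 0) (hfin : ∀ s : ℝ, entropyConj φ (s : EReal) ≠ ⊤)
    (hd : Differentiable ℝ (entropyConjReal φ)) (hX : IsCompact X) (hXne : X.Nonempty)
    (hY : IsCompact Y) [IsFiniteMeasure μ] [IsFiniteMeasure ν] (hμ : μ Xᶜ = 0) (hν : ν Yᶜ = 0)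
    (hac : ν ≪ volume) (hopt : IsOptimal φ X μ ν z₀) (hm : 0 < m) (hz : IsPotential X z)
    (hc : StronglyConvex m z) :
    semiDual φ μ ν z - semiDual φ μ ν z₀ ≥
      ((ENNReal.ofReal (m / 2) *
          gradSqDist (tiltedTarget φ ν z₀) (fenchel z₀) (fenchel z)
        + stabConst φ ν (fenchel z₀) (fenchel z) * sqDist ν (fenchel z₀) (fenchel z)
        + stabConst φ μ z₀ z * sqDist μ z₀ z : ℝ≥0∞) : EReal) := by
  obtain ⟨J, J₀, hJ, hJ₀, h⟩ :=
    stability_estimate_ennreal hφ hfin hd hX hXne hY hμ hν hac hopt hm hz hc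
  have hle := hopt.2 z hz
  rw [hJ, hJ₀, EReal.coe_le_coe_iff] at hle
  refine (EReal.coe_ennreal_le_coe_ennreal_iff.2 h).trans (le_of_eq ?_)
  rw [hJ, hJ₀, EReal.coe_ennreal_ofReal, max_eq_left (sub_nonneg.2 hle), EReal.coe_sub]

/-- If `φ*` is strictly increasing, the conjugate of an optimal potential coincides on the support
of `ν` with a continuous function. -/
lemma IsOptimal.exists_continuous_eq_fenchel (hφ : φ 1 = 0)
    (hfin : ∀ s : ℝ, entropyConj φ (s : EReal) ≠ ⊤)
    (hmono : StrictMono (entropyConjReal φ)) (hX : IsCompact X) (hXne : X.Nonempty)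
    (hY : IsCompact Y) [IsFiniteMeasure μ] [IsFiniteMeasure ν] (hμ : μ Xᶜ = 0) (hν : ν Yᶜ = 0)
    (hopt : IsOptimal φ X μ ν z₀) :
    ∃ f : EuclideanSpace ℝ (Fin d) → ℝ, Continuous f ∧ ∀ y ∈ ν.support, fenchel z₀ y = f y := by
  obtain ⟨R, hR⟩ := hX.exists_bound_of_continuousOn (f := id) continuousOn_id
  simp only [id] at hR
  have hz₀ := hopt.1
  set u := truncate R z₀ with hu_def
  have hu : IsPotential X u := isPotential_truncate hR hz₀
  have hub := hu.1.fenchel_ne_bot hXne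
  have hz₀b := hz₀.1.fenchel_ne_bot hXne
  obtain ⟨x₁, hx₁⟩ := id hXne
  have hut : ∀ y, fenchel u y ≠ ⊤ := fun y =>
    fenchel_truncate_ne_top hz₀.1.ne_bot hz₀.2 (hz₀.1.ne_top x₁ hx₁) y
  have hle : ∀ y, fenchel u y ≤ fenchel z₀ y := fun y => fenchel_anti (le_truncate R) y
  have hJt := semiDual_ne_top (μ := μ) (ν := ν) hφ hfin hX hXne hY hμ hν hu.1 hut
  obtain ⟨-, -, iν, eJ⟩ := semiDual_eq_integral hφ hX hXne hY hμ hν hu.1 hJt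
  obtain ⟨hf₀, -, iν₀, eJ₀⟩ := semiDual_eq_integral hφ hX hXne hY hμ hν hz₀.1
    (ne_top_of_le_ne_top hJt (hopt.2 u hu))
  have hJ := hopt.2 u hu
  -- `u` and `z₀` agree on `X`, so optimality compares only the `ν` terms, where `u* ≤ z₀*` gives
  -- the reverse inequality. Equality of the integrals then gives equality almost everywhere.
  have hμe : ∫ x, entropyConjReal φ ((u x).toReal - quad x) ∂μ
      = ∫ x, entropyConjReal φ ((z₀ x).toReal - quad x) ∂μ := by
    refine integral_congr_ae ?_
    filter_upwards [mem_ae_iff.2 hμ] with x hx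
    rw [hu_def, truncate_of_le (hR x hx)]
  rw [eJ, eJ₀, EReal.coe_le_coe_iff, hμe, add_le_add_iff_left] at hJ
  have hnn : 0 ≤ᵐ[ν] fun y => entropyConjReal φ ((fenchel z₀ y).toReal - quad y)
      - entropyConjReal φ ((fenchel u y).toReal - quad y) := by
    filter_upwards [hf₀] with y hy
    exact sub_nonneg.2 (hmono.monotone (sub_le_sub_right
      (EReal.toReal_le_toReal (hle y) (hub y) hy) _))
  have hzero := (integral_eq_zero_iff_of_nonneg_ae hnn (iν₀.sub iν)).1 (le_antisymm (by
    rw [integral_sub iν₀ iν]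
    linarith) (integral_nonneg_of_ae hnn))
  have hae : ∀ᵐ y ∂ν, fenchel z₀ y = fenchel u y := by
    filter_upwards [hzero, hf₀] with y hy hy'
    have := sub_left_inj.1 (hmono.injective (sub_eq_zero.1 hy))
    rw [← EReal.coe_toReal hy' (hz₀b y), this, EReal.coe_toReal (hut y) (hub y)]
  have hcont := continuous_fenchel_toReal hu.1.ne_bot hub hut
  refine ⟨_, hcont, fun y hy => ?_⟩
  rw [EReal.coe_toReal (hut y) (hub y)]
  -- A strict gap `u* < c < z₀*` at `y` persists nearby, by continuity of `u*` and lower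
  -- semicontinuity of `z₀*`. It would give a `ν`-null neighbourhood of a point of the support.
  refine le_antisymm (le_of_not_gt fun hlt => ?_) (hle y)
  obtain ⟨c, hc₁, hc₂⟩ := EReal.lt_iff_exists_real_btwn.1 hlt
  have h1 : ∀ᶠ v in 𝓝 y, fenchel u v < c := by
    rw [← EReal.coe_toReal (hut y) (hub y), EReal.coe_lt_coe_iff] at hc₁
    filter_upwards [hcont.continuousAt.eventually (gt_mem_nhds hc₁)] with v hv
    rwa [← EReal.coe_toReal (hut v) (hub v), EReal.coe_lt_coe_iff]
  have h2 := lowerSemicontinuous_fenchel hz₀.1.ne_bot y _ hc₂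
  have h3 : ν {v | fenchel u v < c ∧ (c : EReal) < fenchel z₀ v} = 0 :=
    measure_mono_null (fun v hv => fun hv' : fenchel z₀ v = fenchel u v =>
      absurd (hv.1.trans hv.2) (by rw [hv']; exact lt_irrefl _)) (ae_iff.1 hae)
  exact ((Measure.mem_support_iff_forall y).1 hy _ (h1.and h2)).ne' h3

lemma ofReal_le_stabConst {ρ : Measure (EuclideanSpace ℝ (Fin d))}
    {f₀ f : EuclideanSpace ℝ (Fin d) → EReal} {L : ℝ}
    (hd : Differentiable ℝ (entropyConjReal φ))
    (hs : StrongConvexOn (Icc (-L) L) m (entropyConjReal φ))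
    (h₀ : ∀ x ∈ ρ.support, |(f₀ x).toReal - quad x| ≤ L)
    (h : ∀ x ∈ ρ.support, |(f x).toReal - quad x| ≤ L) :
    ENNReal.ofReal (m / 2) ≤ stabConst φ ρ f₀ f := by
  refine le_iInf₂ fun x hx => ?_
  unfold convexityModulus
  split_ifs with hab
  · exact le_top
  · refine ENNReal.ofReal_le_ofReal ?_
    have hpos : 0 < ((f x).toReal - quad x - ((f₀ x).toReal - quad x)) ^ 2 := by
      have := sub_ne_zero.2 (Ne.symm hab)
      positivity
    rw [le_div_iff₀ hpos]
    have := hs.deriv_mul_add_le (abs_le.1 (h₀ x hx)) (abs_le.1 (h x hx)) (hd _)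
    linarith

lemma exists_uniform_stabConst_bound (hφ : φ 1 = 0)
    (hfin : ∀ s : ℝ, entropyConj φ (s : EReal) ≠ ⊤)
    (hd : Differentiable ℝ (entropyConjReal φ)) (hX : IsCompact X) (hXne : X.Nonempty)
    (hY : IsCompact Y) [IsFiniteMeasure μ] [IsFiniteMeasure ν] (hμ : μ Xᶜ = 0) (hν : ν Yᶜ = 0)
    (hopt : IsOptimal φ X μ ν z₀)
    (hs : ∀ s t : ℝ, ∃ m : ℝ, 0 < m ∧ StrongConvexOn (Icc s t) m (entropyConjReal φ)) (M : ℝ) :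
    ∃ C : ℝ, 0 < C ∧ ∀ z : EuclideanSpace ℝ (Fin d) → EReal,
      (∀ x ∈ μ.support, |(z x).toReal| ≤ M) → (∀ y ∈ ν.support, |(fenchel z y).toReal| ≤ M) →
        ENNReal.ofReal C ≤ stabConst φ μ z₀ z ∧
        ENNReal.ofReal C ≤ stabConst φ ν (fenchel z₀) (fenchel z) := by
  obtain ⟨f, hf, hf'⟩ := hopt.exists_continuous_eq_fenchel hφ hfin
    ((entropyConjReal_mono hφ hfin).strictMono_of_strongConvexOn hs) hX hXne hY hμ hν
  have hXs : μ.support ⊆ X := Measure.support_subset_of_isClosed hX.isClosed (mem_ae_iff.2 hμ)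
  have hYs : ν.support ⊆ Y := Measure.support_subset_of_isClosed hY.isClosed (mem_ae_iff.2 hν)
  obtain ⟨K₁, hK₁⟩ := hopt.1.1.exists_bound hX
  obtain ⟨K₂, hK₂⟩ := hY.exists_bound_of_continuousOn (hf.sub continuous_quad).continuousOn
  obtain ⟨Q, hQ⟩ := (hX.union hY).exists_bound_of_continuousOn
    (continuous_quad (d := d)).continuousOn
  -- `K₁` and `K₂` bound the arguments coming from `z₀` and `z₀*`, and `M + Q` those coming from `z`
  -- and `z*`. Hence `L` depends on `z` only through `M`.
  set L := max (max K₁ K₂) (M + Q)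
  have h₁ : K₁ ≤ L := (le_max_left _ _).trans (le_max_left _ _)
  have h₂ : K₂ ≤ L := (le_max_right _ _).trans (le_max_left _ _)
  have h₃ : M + Q ≤ L := le_max_right _ _
  obtain ⟨m, hm, hsm⟩ := hs (-L) L
  refine ⟨m / 2, half_pos hm, fun z hzX hzY => ⟨?_, ?_⟩⟩
  · refine ofReal_le_stabConst hd hsm (fun x hx => (hK₁ x (hXs hx)).trans h₁) fun x hx => ?_
    exact (abs_sub _ _).trans ((add_le_add (hzX x hx) (hQ x (Or.inl (hXs hx)))).trans h₃)
  · refine ofReal_le_stabConst hd hsm (fun y hy => ?_) fun y hy => ?_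
    · rw [hf' y hy, EReal.toReal_coe]
      exact (hK₂ y (hYs hy)).trans h₂
    · exact (abs_sub _ _).trans ((add_le_add (hzY y hy) (hQ y (Or.inr (hYs hy)))).trans h₃)

end UOT

/-! ### The proposition. -/

theorem mainTheorem1 {d : ℕ} (φ : ℝ≥0 → ℝ≥0∞) (hφ : UOT.IsEntropy φ)
    (X Y : Set (EuclideanSpace ℝ (Fin d))) (hX : IsCompact X) (hXne : X.Nonempty)
    (hY : IsCompact Y)
    (μ ν : Measure (EuclideanSpace ℝ (Fin d))) [IsFiniteMeasure μ] [IsFiniteMeasure ν]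
    (hμ : μ Xᶜ = 0) (hν : ν Yᶜ = 0) :
    -- the semi-dual is convex
    (∀ z₁ z₂ : EuclideanSpace ℝ (Fin d) → EReal,
      UOT.IsAdmissible X z₁ → UOT.IsAdmissible X z₂ → ∀ a b : ℝ, 0 ≤ a → 0 ≤ b → a + b = 1 →
        UOT.semiDual φ μ ν (fun x => (a : EReal) * z₁ x + (b : EReal) * z₂ x)
          ≤ (a : EReal) * UOT.semiDual φ μ ν z₁ + (b : EReal) * UOT.semiDual φ μ ν z₂) ∧
    -- stability
    ((∀ s : ℝ, UOT.entropyConj φ (s : EReal) ≠ ⊤) → Differentiable ℝ (UOT.entropyConjReal φ) →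
      ν ≪ volume → ∀ z₀ : EuclideanSpace ℝ (Fin d) → EReal, UOT.IsOptimal φ X μ ν z₀ →
      (∀ lam : ℝ, 0 < lam → ∀ z : EuclideanSpace ℝ (Fin d) → EReal,
        UOT.IsPotential X z → UOT.StronglyConvex lam z →
          -- the quantities in the estimate are meaningful
          ((∃ r : ℝ, UOT.semiDual φ μ ν z = (r : EReal)) ∧
            (∃ r : ℝ, UOT.semiDual φ μ ν z₀ = (r : EReal)) ∧
            (∀ᵐ y ∂ν, UOT.fenchel z₀ y ≠ ⊥ ∧ UOT.fenchel z₀ y ≠ ⊤ ∧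
              DifferentiableAt ℝ (fun u => (UOT.fenchel z₀ u).toReal) y) ∧
            (∀ y, UOT.fenchel z y ≠ ⊥ ∧ UOT.fenchel z y ≠ ⊤) ∧
            Differentiable ℝ (fun u => (UOT.fenchel z u).toReal)) ∧
          -- the estimate
          UOT.semiDual φ μ ν z - UOT.semiDual φ μ ν z₀ ≥
            ((ENNReal.ofReal (lam / 2) *
                UOT.gradSqDist (UOT.tiltedTarget φ ν z₀) (UOT.fenchel z₀) (UOT.fenchel z)
              + UOT.stabConst φ ν (UOT.fenchel z₀) (UOT.fenchel z) *
                UOT.sqDist ν (UOT.fenchel z₀) (UOT.fenchel z)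
              + UOT.stabConst φ μ z₀ z * UOT.sqDist μ z₀ z : ℝ≥0∞) : EReal)) ∧
      -- uniform positivity of the constants
      ((∀ s t : ℝ, ∃ m : ℝ, 0 < m ∧ StrongConvexOn (Icc s t) m (UOT.entropyConjReal φ)) →
        ∀ M : ℝ, ∃ C' : ℝ, 0 < C' ∧ ∀ lam : ℝ, 0 < lam →
          ∀ z : EuclideanSpace ℝ (Fin d) → EReal,
          UOT.IsPotential X z → UOT.StronglyConvex lam z →
          (∀ x ∈ μ.support, |(z x).toReal| ≤ M) →
          (∀ y ∈ ν.support, |(UOT.fenchel z y).toReal| ≤ M) →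
            ENNReal.ofReal C' ≤ UOT.stabConst φ μ z₀ z ∧
            ENNReal.ofReal C' ≤ UOT.stabConst φ ν (UOT.fenchel z₀) (UOT.fenchel z) ∧
            -- local strong convexity in an `H¹`-type norm
            UOT.semiDual φ μ ν z - UOT.semiDual φ μ ν z₀ ≥
              ((ENNReal.ofReal (lam / 2) *
                  UOT.gradSqDist (UOT.tiltedTarget φ ν z₀) (UOT.fenchel z₀) (UOT.fenchel z)
                + ENNReal.ofReal C' * (UOT.sqDist ν (UOT.fenchel z₀) (UOT.fenchel z)
                  + UOT.sqDist μ z₀ z) : ℝ≥0∞) : EReal))) := by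
  refine ⟨fun z₁ z₂ h₁ h₂ a b ha hb hab =>
    UOT.semiDual_convex hφ.map_one hX hXne hY hμ hν h₁ h₂ ha hb hab, ?_⟩
  intro hfin hd hac z₀ hopt
  have hest := fun (lam : ℝ) (hlam : 0 < lam) (z : EuclideanSpace ℝ (Fin d) → EReal)
      (hz : UOT.IsPotential X z) (hc : UOT.StronglyConvex lam z) =>
    UOT.stability_estimate hφ.map_one hfin hd hX hXne hY hμ hν hac hopt hlam hz hc
  refine ⟨fun lam hlam z hz hc => ⟨?_, hest lam hlam z hz hc⟩, fun hs M => ?_⟩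
  · obtain ⟨J, J₀, hJ, hJ₀, -⟩ := UOT.stability_estimate_ennreal hφ.map_one hfin hd hX hXne hY hμ
      hν hac hopt hlam hz hc
    have hb := hz.1.fenchel_ne_bot hXne
    have hb₀ := hopt.1.1.fenchel_ne_bot hXne
    have ht : ∀ y, UOT.fenchel z y ≠ ⊤ := fun y =>
      UOT.StronglyConvex.fenchel_ne_top hz.1.ne_bot hlam hz.2 hc
        (hz.1.ne_top _ hXne.some_mem) y
    have ht₀ := (UOT.semiDual_eq_integral hφ.map_one hX hXne hY hμ hν hopt.1.1
      (by rw [hJ₀]; exact EReal.coe_ne_top _)).1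
    refine ⟨⟨J, hJ⟩, ⟨J₀, hJ₀⟩, ?_, fun y => ⟨hb y, ht y⟩, fun y => ?_⟩
    · filter_upwards [ht₀, UOT.ae_differentiableAt_fenchel hopt.1.1.ne_bot hb₀ hac ht₀] with y h h'
      exact ⟨hb₀ y, h, h'.2⟩
    · obtain ⟨S, hS, -⟩ := hc.hasGradientAt_fenchel hz.1.ne_bot hlam
        (f := fun y => (UOT.fenchel z y).toReal) (fun y => (EReal.coe_toReal (ht y) (hb y)).symm) y
      exact hS.differentiableAt
  · obtain ⟨C, hC, hCz⟩ := UOT.exists_uniform_stabConst_bound hφ.map_one hfin hd hX hXne hY hμ hν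
      hopt hs M
    refine ⟨C, hC, fun lam hlam z hz hc hzX hzY => ?_⟩
    obtain ⟨h₁, h₂⟩ := hCz z hzX hzY
    refine ⟨h₁, h₂, le_trans ?_ (hest lam hlam z hz hc)⟩
    rw [EReal.coe_ennreal_le_coe_ennreal_iff, mul_add, ← add_assoc]
    gcongr
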